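/- Let $\mathbb T^d=\mathbb R^d/\mathbb Z^d$, let $A$ be a constant symmetric positive definite $d\times d$ matrix, let $a_0,a_1:\mathbb T^d\to(0,\infty)$ be continuous, and let $h\in\mathbb R$. Write $A:Q=\sum_{i,j}A_{ij}Q_{ij}$, and for a positive function $b$ on $\mathbb T^d$ let $\mathrm{HM}(b)=\left(\int_{\mathbb T^d}b(y)^{-1}\,dy\right)^{-1}$ be its harmonic mean. For symmetric $Q$ let $$H(Q,y)=\max\{-a_0(y)\,A:Q,\;-(a_0(y)+a_1(y))\,A:Q\}+h .$$ Let $\overline H(Q)$ denote the unique number $c$ for which the cell problem $H(Q+D^2u(y),y)=c$ has a continuous viscosity solution $u:\mathbb T^d\to\mathbb R$. Then, for every symmetric $Q$, such a number exists, is unique, and $$\overline H(Q)=\max\{-\mathrm{HM}(a_0)\,A:Q,\;-\mathrm{HM}(a_0+a_1)\,A:Q\}+h .$$ Moreover, let $L_t(Q,y)=-(a_0(y)+t\,a_1(y))\,A:Q+h$ for $t\in[0,1]$, so that $H(Q,y)=\max_{t\in[0,1]}L_t(Q,y)$. A control is a Borel measurable function $\alpha:\mathbb T^d\to[0,1]$;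 put $b=a_0+\alpha a_1$. 1. There is exactly one invariant measure for the control $\alpha$, that is, one Borel probability measure $\rho$ on $\mathbb T^d$ with $\int_{\mathbb T^d} b(y)\,A:D^2\varphi(y)\,d\rho(y)=0$ for all $\varphi\in C^2(\mathbb T^d)$, namely $d\rho=\frac{\mathrm{HM}(b)}{b(y)}\,dy$. 2. The homogenized linear operator of the control, $\overline{L_\alpha}(Q)=\int_{\mathbb T^d}L_{\alpha(y)}(Q,y)\,d\rho(y)$, equals $-\mathrm{HM}(b)\,A:Q+h$. 3. For every symmetric $Q$, $\overline H(Q)=\max_{\alpha}\overline{L_\alpha}(Q)$, the maximum being over all controls; it is attained at the constant control $\alpha\equiv0$ if $A:Q\ge0$ and at the constant control $\alpha\equiv1$ if $A:Q\le0$. -/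

import Mathlib

open MeasureTheory Set

noncomputable section

namespace PeriodicCell

/-- The `d`-dimensional flat torus `ℝ^d / ℤ^d`. -/
abbrev Torus (d : ℕ) : Type := UnitAddTorus (Fin d)

/-- The projection `ℝ^d → ℝ^d / ℤ^d`. -/
def proj {d : ℕ} (v : Fin d → ℝ) : Torus d := fun i => (v i : UnitAddCircle)

/-- The product `A : B = ∑ i j, A i j * B i j` of two matrices. -/
def frob {d : ℕ} (A B : Matrix (Fin d) (Fin d) ℝ) : ℝ := ∑ i, ∑ j, A i j * B i j

/-- The matrix of second partial derivatives of `φ : ℝ^d → ℝ` at `x`. -/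
def hess {d : ℕ} (φ : (Fin d → ℝ) → ℝ) (x : Fin d → ℝ) : Matrix (Fin d) (Fin d) ℝ :=
  Matrix.of fun i j => fderiv ℝ (fderiv ℝ φ) x (Pi.single i 1) (Pi.single j 1)

/-- `φ ∈ C²(𝕋^d)`: the periodic lift of `φ` to `ℝ^d` is `C²`. -/
def IsC2 {d : ℕ} (φ : Torus d → ℝ) : Prop := ContDiff ℝ 2 fun v => φ (proj v)

/-- The Hessian of `φ : 𝕋^d → ℝ` at `y`, computed in the coordinates `v ↦ y + v`. -/
def torusHess {d : ℕ} (φ : Torus d → ℝ) (y : Torus d) : Matrix (Fin d) (Fin d) ℝ :=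
  hess (fun v => φ (y + proj v)) 0

/-- `u` is a viscosity subsolution on the torus of `H (Q + D²u, y) = c`
(for `H` nonincreasing in its matrix argument). -/
def IsViscositySubsolution {d : ℕ} (H : Matrix (Fin d) (Fin d) ℝ → Torus d → ℝ)
    (Q : Matrix (Fin d) (Fin d) ℝ) (c : ℝ) (u : Torus d → ℝ) : Prop :=
  ∀ (y : Torus d) (φ : (Fin d → ℝ) → ℝ), ContDiff ℝ 2 φ →
    IsLocalMax (fun v => u (y + proj v) - φ v) 0 → H (Q + hess φ 0) y ≤ c

/-- `u` is a viscosity supersolution on the torus of `H (Q + D²u, y) = c`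
(for `H` nonincreasing in its matrix argument). -/
def IsViscositySupersolution {d : ℕ} (H : Matrix (Fin d) (Fin d) ℝ → Torus d → ℝ)
    (Q : Matrix (Fin d) (Fin d) ℝ) (c : ℝ) (u : Torus d → ℝ) : Prop :=
  ∀ (y : Torus d) (φ : (Fin d → ℝ) → ℝ), ContDiff ℝ 2 φ →
    IsLocalMin (fun v => u (y + proj v) - φ v) 0 → c ≤ H (Q + hess φ 0) y

/-- The cell problem `H (Q + D²u, y) = c` has a (continuous, periodic) viscosity solution `u`.
The homogenized operator at `Q` is the unique `c` with this property. -/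
def IsCellValue {d : ℕ} (H : Matrix (Fin d) (Fin d) ℝ → Torus d → ℝ)
    (Q : Matrix (Fin d) (Fin d) ℝ) (c : ℝ) : Prop :=
  ∃ u : Torus d → ℝ, Continuous u ∧
    IsViscositySubsolution H Q c u ∧ IsViscositySupersolution H Q c u

/-- The harmonic mean of a positive function on the torus. -/
def harmonicMean {d : ℕ} (b : Torus d → ℝ) : ℝ := (∫ y, (b y)⁻¹)⁻¹

/-- The maximum of two linear operators,
`H(Q,y) = max {-a₀(y) A:Q, -(a₀(y) + a₁(y)) A:Q} + h`. -/
def maxOp {d : ℕ} (a₀ a₁ : Torus d → ℝ) (A : Matrix (Fin d) (Fin d) ℝ) (h : ℝ)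
    (Q : Matrix (Fin d) (Fin d) ℝ) (y : Torus d) : ℝ :=
  max (-(a₀ y * frob A Q)) (-((a₀ y + a₁ y) * frob A Q)) + h

/-- The linear operator `L_t(Q,y) = -(a₀(y) + t a₁(y)) A:Q + h` for the control value `t`. -/
def linOp {d : ℕ} (a₀ a₁ : Torus d → ℝ) (A : Matrix (Fin d) (Fin d) ℝ) (h : ℝ) (t : ℝ)
    (Q : Matrix (Fin d) (Fin d) ℝ) (y : Torus d) : ℝ :=
  -((a₀ y + t * a₁ y) * frob A Q) + h

/-- An admissible control: a measurable function from the torus to `[0,1]`. -/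
def IsControl {d : ℕ} (α : Torus d → ℝ) : Prop := Measurable α ∧ ∀ y, α y ∈ Icc (0 : ℝ) 1

/-- `ρ` is an invariant probability measure for the operator with diffusion matrix `M(y)`:
`D² : (M ρ) = 0` in the weak sense. -/
def IsInvariantMeasure {d : ℕ} (M : Torus d → Matrix (Fin d) (Fin d) ℝ)
    (ρ : Measure (Torus d)) : Prop :=
  IsProbabilityMeasure ρ ∧
    ∀ φ : Torus d → ℝ, IsC2 φ → ∫ y, frob (M y) (torusHess φ y) ∂ρ = 0

/-- `c` is the value at `Q` of the homogenized linear operator of the control `α`: the average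
of `L_{α(y)}(Q,y)` against an invariant measure of that control. -/
def IsLinearValue {d : ℕ} (a₀ a₁ : Torus d → ℝ) (A : Matrix (Fin d) (Fin d) ℝ) (h : ℝ)
    (α : Torus d → ℝ) (Q : Matrix (Fin d) (Fin d) ℝ) (c : ℝ) : Prop :=
  ∃ ρ : Measure (Torus d), IsInvariantMeasure (fun y => (a₀ y + α y * a₁ y) • A) ρ ∧
    c = ∫ y, linOp a₀ a₁ A h (α y) Q y ∂ρ

end PeriodicCell

end

open PeriodicCell

noncomputable section

namespace PeriodicCell

open UnitAddTorus Filter Topology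

section

variable {d : ℕ}

/-! For positive `a ≤ b` the map `s ↦ max (-a s) (-b s)` is a decreasing bijection of the line, so
at each `y` the relation `H(P,y) = c` can be solved for the single number `A : P`. The nonlinear
cell problem is therefore the linear equation `A : D²u = g_c(y) - A : Q`, where `g_c` is a pointwise
inverse whose branch depends on the sign of `c - h` only. This equation is solvable exactly when the
right side has mean zero. Since the branch does not depend on `y`, the mean of `g_c` is the same
inverse formed with harmonic means, and inverting back gives the formula (`isCellValue_iff`).

The analytic input is the solution of `A : D²u = f` for continuous `f` of mean zero, as a uniform
limit of trigonometric polynomials with uniformly converging data (`exists_approx_solution`). It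
rests on a supremum norm bound (`exists_norm_trigPoly_le`): the resolvent `R = (1 - ε A : D²)⁻¹` is
a contraction by the maximum principle, its `d`-th power halves the norm on mean-zero polynomials
when `ε` is large, and `u - R^d u` telescopes to at most `d ε ‖A : D²u‖`. Perturbed test functions
pass the viscosity inequalities to the limit.

The same approximate solutions show that a finite measure annihilating every `A : D²φ` is a multiple
of Lebesgue measure. Applied to `b ρ`, this determines the invariant measures. The maximum over
controls then follows from monotonicity of the harmonic mean. -/

instance : IsProbabilityMeasure (volume : Measure UnitAddCircle) := ⟨UnitAddCircle.measure_univ⟩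

/-! ### The torus as a quotient, and derivatives of trigonometric polynomials. -/

lemma proj_add (v w : Fin d → ℝ) : proj (v + w) = proj v + proj w := by
  ext i; simp [proj]

lemma proj_zero : proj (0 : Fin d → ℝ) = 0 := by
  ext i; simp [proj]

lemma proj_surjective : Function.Surjective (proj : (Fin d → ℝ) → Torus d) := fun y =>
  ⟨fun i => (QuotientAddGroup.mk_surjective (y i)).choose, by
    ext i; exact (QuotientAddGroup.mk_surjective (y i)).choose_spec⟩

lemma continuous_proj : Continuous (proj : (Fin d → ℝ) → Torus d) :=
  continuous_pi fun i => (AddCircle.continuous_mk' 1).comp (continuous_apply i)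

lemma isQuotientMap_proj : IsQuotientMap (proj : (Fin d → ℝ) → Torus d) :=
  (IsOpenQuotientMap.piMap fun _ : Fin d =>
    (QuotientAddGroup.isOpenQuotientMap_mk : IsOpenQuotientMap
      (QuotientAddGroup.mk : ℝ → UnitAddCircle))).isQuotientMap

/-- Trigonometric polynomials on the torus, in terms of their coefficients. -/
def trigPoly : ((Fin d → ℤ) →₀ ℂ) →ₗ[ℂ] C(Torus d, ℂ) :=
  Finsupp.linearCombination ℂ mFourier

lemma trigPoly_eq_sum (c : (Fin d → ℤ) →₀ ℂ) : trigPoly c = ∑ k ∈ c.support, c k • mFourier k := rfl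

lemma trigPoly_apply (c : (Fin d → ℤ) →₀ ℂ) (y : Torus d) :
    trigPoly c y = ∑ k ∈ c.support, c k * mFourier k y := by
  simp [trigPoly_eq_sum]

lemma trigPoly_smul_apply (m : (Fin d → ℤ) → ℂ) (c : (Fin d → ℤ) →₀ ℂ) (y : Torus d) :
    trigPoly (m • c) y = ∑ k ∈ c.support, m k * c k * mFourier k y := by
  rw [trigPoly_apply]
  change _ = ∑ k ∈ c.support, (m • c) k * mFourier k y
  refine Finset.sum_subset (fun k hk => ?_) (fun k _ hk => ?_)
  · simp only [Finsupp.mem_support_iff, Finsupp.coe_pointwise_smul, Pi.smul_apply', smul_eq_mul,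
      ne_eq, mul_eq_zero, not_or] at hk ⊢
    exact hk.2
  · rw [Finsupp.notMem_support_iff.mp hk, zero_mul]

lemma mFourier_add_proj (k : Fin d → ℤ) (y : Torus d) (v : Fin d → ℝ) :
    mFourier k (y + proj v) =
      mFourier k y * Complex.exp (2 * Real.pi * Complex.I * ∑ i, (k i : ℂ) * v i) := by
  simp only [mFourier, ContinuousMap.coe_mk, Pi.add_apply, proj, Finset.mul_sum, Complex.exp_sum,
    ← Finset.prod_mul_distrib]
  refine Finset.prod_congr rfl fun i _ => ?_
  rw [fourier_apply, smul_add, AddCircle.toCircle_add, Circle.coe_mul, ← fourier_apply,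
    ← fourier_apply, fourier_coe_apply]
  congr 2
  push_cast
  ring

/-- Each partial derivative is again a trigonometric polynomial, with multiplier `2πi k_i`; hence
smoothness and the Hessian follow by iteration. -/
lemma hasFDerivAt_re_trigPoly (c : (Fin d → ℤ) →₀ ℂ) (y : Torus d) (v : Fin d → ℝ) :
    HasFDerivAt (fun v => (trigPoly c (y + proj v)).re)
      (∑ i, (trigPoly ((fun k : Fin d → ℤ => (2 * Real.pi * Complex.I * k i : ℂ)) • c) (y + proj v)).re •
        (ContinuousLinearMap.proj i : (Fin d → ℝ) →L[ℝ] ℝ)) v := by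
  have h1 : ∀ k : Fin d → ℤ, HasFDerivAt (fun v : Fin d → ℝ => c k * mFourier k (y + proj v))
      (∑ i, (2 * Real.pi * Complex.I * k i * c k * mFourier k (y + proj v)) •
        Complex.ofRealCLM.comp (ContinuousLinearMap.proj i : (Fin d → ℝ) →L[ℝ] ℝ)) v := by
    intro k
    simp only [mFourier_add_proj]
    have h2 : HasFDerivAt (fun v : Fin d → ℝ => 2 * Real.pi * Complex.I * ∑ i, (k i : ℂ) * v i)
        ((2 * Real.pi * Complex.I : ℂ) • ∑ i, (k i : ℂ) •
          Complex.ofRealCLM.comp (ContinuousLinearMap.proj i : (Fin d → ℝ) →L[ℝ] ℝ)) v := by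
      refine HasFDerivAt.const_mul (HasFDerivAt.fun_sum fun i _ => HasFDerivAt.const_mul ?_ _) _
      exact (Complex.ofRealCLM.comp (ContinuousLinearMap.proj i : (Fin d → ℝ) →L[ℝ] ℝ)).hasFDerivAt
    refine ((h2.cexp.const_mul (mFourier k y)).const_mul (c k)).congr_fderiv ?_
    ext w
    simp [Finset.mul_sum]
    refine Finset.sum_congr rfl fun i _ => ?_
    ring
  have h3 := Complex.reCLM.hasFDerivAt.comp v (HasFDerivAt.fun_sum fun k (_ : k ∈ c.support) => h1 k)
  simp only [trigPoly_smul_apply]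
  simp only [trigPoly_apply]
  refine h3.congr_fderiv ?_
  ext w
  simp
  rw [Finset.sum_comm]
  refine Finset.sum_congr rfl fun i _ => ?_
  rw [← Finset.sum_mul, Finset.sum_sub_distrib, Finset.sum_neg_distrib]

lemma fderiv_re_trigPoly (c : (Fin d → ℤ) →₀ ℂ) (y : Torus d) :
    fderiv ℝ (fun v => (trigPoly c (y + proj v)).re) = fun v =>
      (∑ i, (trigPoly ((fun k : Fin d → ℤ => (2 * Real.pi * Complex.I * k i : ℂ)) • c) (y + proj v)).re •
        (ContinuousLinearMap.proj i : (Fin d → ℝ) →L[ℝ] ℝ)) :=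
  funext fun v => (hasFDerivAt_re_trigPoly c y v).fderiv

lemma contDiff_re_trigPoly (c : (Fin d → ℤ) →₀ ℂ) (y : Torus d) (n : ℕ) :
    ContDiff ℝ n (fun v => (trigPoly c (y + proj v)).re) := by
  induction n generalizing c with
  | zero =>
    rw [Nat.cast_zero, contDiff_zero]
    exact Complex.continuous_re.comp
      ((trigPoly c).continuous.comp (continuous_const.add continuous_proj))
  | succ n ih =>
    rw [Nat.cast_succ, contDiff_succ_iff_fderiv]
    refine ⟨fun v => (hasFDerivAt_re_trigPoly c y v).differentiableAt, by simp, ?_⟩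
    rw [fderiv_re_trigPoly]
    exact ContDiff.sum fun i _ => (ih _).smul contDiff_const

lemma hess_re_trigPoly (c : (Fin d → ℤ) →₀ ℂ) (y : Torus d) (v : Fin d → ℝ) :
    hess (fun v => (trigPoly c (y + proj v)).re) v = Matrix.of fun i j =>
      (trigPoly ((fun k : Fin d → ℤ => (-(4 * Real.pi ^ 2 * k i * k j) : ℂ)) • c) (y + proj v)).re := by
  have h2 := HasFDerivAt.fun_sum (u := Finset.univ) fun (i : Fin d) _ =>
    (hasFDerivAt_re_trigPoly ((fun k : Fin d → ℤ => (2 * Real.pi * Complex.I * k i : ℂ)) • c) y v).smul_const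
      (ContinuousLinearMap.proj i : (Fin d → ℝ) →L[ℝ] ℝ)
  ext i j
  rw [hess, fderiv_re_trigPoly, h2.fderiv]
  simp [Pi.single_apply, smul_smul]
  congr 3
  ext k
  simp
  ring_nf
  simp

/-- The Fourier symbol of the operator `-A : D²`. -/
def symbol (A : Matrix (Fin d) (Fin d) ℝ) (k : Fin d → ℤ) : ℝ :=
  4 * Real.pi ^ 2 * ∑ i, ∑ j, A i j * (k i * k j)

lemma isC2_re_trigPoly (c : (Fin d → ℤ) →₀ ℂ) : IsC2 fun y => (trigPoly c y).re := by
  simpa [IsC2] using contDiff_re_trigPoly c 0 2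

lemma frob_torusHess_re_trigPoly (A : Matrix (Fin d) (Fin d) ℝ) (c : (Fin d → ℤ) →₀ ℂ)
    (y : Torus d) :
    frob A (torusHess (fun y => (trigPoly c y).re) y) =
      -(trigPoly ((fun k : Fin d → ℤ => (symbol A k : ℂ)) • c) y).re := by
  rw [torusHess, hess_re_trigPoly, frob]
  simp only [Matrix.of_apply, proj_zero, add_zero, trigPoly_smul_apply, symbol, Complex.re_sum,
    Finset.mul_sum, ← Finset.sum_neg_distrib]
  have : ∀ i j, ∑ k ∈ c.support,
      A i j * (-(4 * Real.pi ^ 2 * (k i : ℂ) * k j) * c k * mFourier k y).re =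
      ∑ k ∈ c.support, -(4 * Real.pi ^ 2 * (A i j * (k i * k j)) * (c k * mFourier k y).re) := by
    intro i j
    refine Finset.sum_congr rfl fun k _ => ?_
    have : (-(4 * Real.pi ^ 2 * (k i : ℂ) * k j) * c k * mFourier k y) =
      ((-(4 * Real.pi ^ 2 * (k i : ℝ) * k j) : ℝ) : ℂ) * (c k * mFourier k y) := by
      push_cast; ring
    rw [this, Complex.re_ofReal_mul]
    ring
  simp only [this]
  rw [Finset.sum_congr rfl fun i _ => Finset.sum_comm, Finset.sum_comm]
  refine Finset.sum_congr rfl fun k _ => ?_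
  rw [mul_assoc, Complex.re_ofReal_mul]
  simp only [Finset.sum_mul, Finset.sum_neg_distrib]

/-! ### Second derivative test and ellipticity of the symbol. -/

lemma fderiv_fderiv_nonpos_of_isLocalMax {E : Type*} [NormedAddCommGroup E] [NormedSpace ℝ E]
    {ψ : E → ℝ} {x : E} (hψ : ContDiff ℝ 2 ψ) (hx : IsLocalMax ψ x) (v : E) :
    fderiv ℝ (fderiv ℝ ψ) x v v ≤ 0 := by
  by_contra! hB
  set B := fderiv ℝ (fderiv ℝ ψ) x v v with hBdef
  have hl : ∀ t : ℝ, HasDerivAt (fun t : ℝ => x + t • v) v t := fun t => by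
    simpa using ((hasDerivAt_id t).smul_const v).const_add x
  -- Subtracting `B/4 t²` leaves second derivative `B/2 > 0` at `0`, hence a local minimum there; so
  -- `ψ` grows at least quadratically along `v`, against maximality.
  have h1 : ∀ t : ℝ, HasDerivAt (fun t : ℝ => ψ (x + t • v) - B / 4 * t ^ 2)
      (fderiv ℝ ψ (x + t • v) v - B / 2 * t) t := by
    intro t
    have := ((hψ.differentiable (by norm_num)) (x + t • v)).hasFDerivAt.comp_hasDerivAt t (hl t)
    refine (this.sub ((hasDerivAt_pow 2 t).const_mul (B / 4))).congr_deriv ?_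
    norm_num
    ring
  have h2 : HasDerivAt (fun t : ℝ => fderiv ℝ ψ (x + t • v) v - B / 2 * t) (B - B / 2) 0 := by
    have hd : Differentiable ℝ (fderiv ℝ ψ) :=
      (hψ.fderiv_right (m := 1) (by norm_num)).differentiable (by norm_num)
    have h3 := (hd (x + (0 : ℝ) • v)).hasFDerivAt.comp_hasDerivAt 0 (hl 0)
    have h4 := h3.clm_apply (hasDerivAt_const (0 : ℝ) v)
    refine (h4.sub ((hasDerivAt_id (0 : ℝ)).const_mul (B / 2))).congr_deriv ?_
    simp [hBdef]
  have hderiv : deriv (fun t : ℝ => ψ (x + t • v) - B / 4 * t ^ 2) =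
      fun t => fderiv ℝ ψ (x + t • v) v - B / 2 * t := funext fun t => (h1 t).deriv
  have hmin : IsLocalMin (fun t : ℝ => ψ (x + t • v) - B / 4 * t ^ 2) 0 := by
    apply isLocalMin_of_deriv_deriv_pos
    · rw [hderiv, h2.deriv]; linarith
    · rw [hderiv]; simp [hx.fderiv_eq_zero]
    · exact (h1 0).continuousAt
  have hmax : ∀ᶠ t in 𝓝 (0 : ℝ), ψ (x + t • v) ≤ ψ x := by
    have : Tendsto (fun t : ℝ => x + t • v) (𝓝 0) (𝓝 x) := by
      simpa using (hl 0).continuousAt.tendsto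
    exact this.eventually hx
  have h0 : ∀ᶠ t in 𝓝[≠] (0 : ℝ), False := by
    filter_upwards [nhdsWithin_le_nhds hmax, nhdsWithin_le_nhds hmin, self_mem_nhdsWithin]
      with t ht1 ht2 ht3
    have : 0 < t ^ 2 := by have : t ≠ 0 := ht3; positivity
    simp at ht2
    nlinarith
  simpa using h0.exists

lemma sum_mul_hess (φ : (Fin d → ℝ) → ℝ) (x v : Fin d → ℝ) :
    fderiv ℝ (fderiv ℝ φ) x v v = ∑ i, ∑ j, v i * v j * hess φ x i j := by
  have hv : v = ∑ i, v i • (Pi.single i 1 : Fin d → ℝ) := by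
    ext j; simp [Finset.sum_apply, Pi.single_apply]
  conv_lhs => rw [hv]
  simp only [map_sum, map_smul, sum_apply, smul_apply, smul_eq_mul, hess, Matrix.of_apply,
    Finset.mul_sum]
  rw [Finset.sum_comm]
  refine Finset.sum_congr rfl fun i _ => Finset.sum_congr rfl fun j _ => ?_
  ring

/-- Writing `A = XᵀX` turns `A : B` into the sum of the quadratic form of `B` over the rows of `X`.
-/
lemma frob_nonpos {A B : Matrix (Fin d) (Fin d) ℝ} (hA : A.PosSemidef)
    (hB : ∀ v : Fin d → ℝ, ∑ i, ∑ j, v i * v j * B i j ≤ 0) : frob A B ≤ 0 := by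
  open scoped MatrixOrder in
  obtain ⟨X, rfl⟩ := CStarAlgebra.nonneg_iff_eq_star_mul_self.mp hA.nonneg
  have : frob (star X * X) B = ∑ k, ∑ i, ∑ j, X k i * X k j * B i j := by
    simp only [frob, Matrix.mul_apply, Matrix.star_apply, star_trivial, Finset.sum_mul]
    rw [Finset.sum_congr rfl fun i _ => Finset.sum_comm, Finset.sum_comm]
  rw [this]
  exact Finset.sum_nonpos fun k _ => hB _

/-- The second derivative test for the operator `A : D²`. -/
lemma frob_hess_nonpos {A : Matrix (Fin d) (Fin d) ℝ} (hA : A.PosSemidef)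
    {φ : (Fin d → ℝ) → ℝ} {x : Fin d → ℝ} (hφ : ContDiff ℝ 2 φ) (hx : IsLocalMax φ x) :
    frob A (hess φ x) ≤ 0 :=
  frob_nonpos hA fun v => by
    rw [← sum_mul_hess]; exact fderiv_fderiv_nonpos_of_isLocalMax hφ hx v

lemma symbol_nonneg {A : Matrix (Fin d) (Fin d) ℝ} (hA : A.PosSemidef) (k : Fin d → ℤ) :
    0 ≤ symbol A k := by
  have := frob_nonpos (B := Matrix.of fun i j => -((k i : ℝ) * k j)) hA fun v => by
    have : ∑ i, ∑ j, v i * v j * (Matrix.of fun i j => -((k i : ℝ) * k j)) i j =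
        -(∑ i, v i * k i) ^ 2 := by
      rw [sq, Finset.sum_mul_sum, ← Finset.sum_neg_distrib]
      refine Finset.sum_congr rfl fun i _ => ?_
      rw [← Finset.sum_neg_distrib]
      refine Finset.sum_congr rfl fun j _ => ?_
      simp; ring
    rw [this]; nlinarith [sq_nonneg (∑ i, v i * k i)]
  have h2 : frob A (Matrix.of fun i j => -((k i : ℝ) * k j)) =
      -∑ i, ∑ j, A i j * (k i * k j) := by
    simp [frob]
  rw [symbol]
  have : 0 ≤ ∑ i, ∑ j, A i j * ((k i : ℝ) * k j) := by linarith
  positivity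

/-- Compactness of the unit sphere and homogeneity give quadratic growth. The bound is stated for
each coordinate separately so that a product of `d` such bounds is summable over `ℤ^d`. -/
lemma exists_symbol_ge {A : Matrix (Fin d) (Fin d) ℝ} (hA : A.PosDef) :
    ∃ l > 0, ∀ (k : Fin d → ℤ) (i : Fin d), k ≠ 0 → l * (1 + (k i : ℝ) ^ 2) ≤ symbol A k := by
  obtain rfl | hd := d.eq_zero_or_pos
  · exact ⟨1, one_pos, fun _ i => i.elim0⟩
  have : Nonempty (Fin d) := ⟨⟨0, hd⟩⟩
  set F : (Fin d → ℝ) → ℝ := fun v => ∑ i, ∑ j, A i j * (v i * v j) with hF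
  have hFc : Continuous F := by fun_prop
  have hFpos : ∀ v, v ≠ 0 → 0 < F v := fun v hv => by
    have := hA.dotProduct_mulVec_pos hv
    simp only [dotProduct, Matrix.mulVec, Finset.mul_sum, star_trivial] at this
    refine this.trans_eq (Finset.sum_congr rfl fun i _ => Finset.sum_congr rfl fun j _ => ?_)
    ring
  obtain ⟨v₀, hv₀, hmin⟩ := (isCompact_sphere (0 : Fin d → ℝ) 1).exists_isMinOn
    (NormedSpace.sphere_nonempty.mpr zero_le_one) hFc.continuousOn
  have hm : 0 < F v₀ := hFpos _ fun h => by simp [h] at hv₀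
  have hhom : ∀ v, F v₀ * ‖v‖ ^ 2 ≤ F v := by
    intro v
    obtain rfl | hv := eq_or_ne v 0
    · simp [hF]
    have hn : 0 < ‖v‖ := norm_pos_iff.mpr hv
    have h1 := isMinOn_iff.mp hmin (‖v‖⁻¹ • v) (by simp [norm_smul, hn.ne'])
    have h2 : F (‖v‖⁻¹ • v) = F v / ‖v‖ ^ 2 := by
      simp only [hF, Pi.smul_apply, smul_eq_mul, Finset.sum_div]
      refine Finset.sum_congr rfl fun i _ => Finset.sum_congr rfl fun j _ => ?_
      field_simp
    rw [h2, le_div_iff₀ (by positivity)] at h1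
    exact h1
  -- The half comes from `1 + k_i² ≤ 2‖k‖²`, as a nonzero integer vector has norm at least `1`.
  refine ⟨4 * Real.pi ^ 2 * (F v₀ / 2), by positivity, fun k i hk => ?_⟩
  have h1 := hhom fun i => (k i : ℝ)
  have h2 : |(k i : ℝ)| ≤ ‖fun i => (k i : ℝ)‖ := norm_le_pi_norm (fun i => (k i : ℝ)) i
  have h3 : 1 ≤ ‖fun i => (k i : ℝ)‖ := by
    obtain ⟨j, hj⟩ := Function.ne_iff.mp hk
    refine le_trans ?_ (norm_le_pi_norm (fun i => (k i : ℝ)) j)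
    rw [Real.norm_eq_abs]
    exact_mod_cast Int.one_le_abs hj
  rw [symbol, mul_assoc]
  refine mul_le_mul_of_nonneg_left ?_ (by positivity)
  refine le_trans ?_ h1
  have h4 : (k i : ℝ) ^ 2 ≤ ‖fun i => (k i : ℝ)‖ ^ 2 := by rw [← sq_abs]; gcongr
  have h5 : 1 ≤ ‖fun i => (k i : ℝ)‖ ^ 2 := one_le_pow₀ h3
  nlinarith

/-! ### Fourier coefficients and the supremum norm estimate. -/

lemma integral_mFourier {k : Fin d → ℤ} (hk : k ≠ 0) : ∫ y : Torus d, mFourier k y = 0 := by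
  obtain ⟨j, hj⟩ := Function.ne_iff.mp hk
  have h1 := integral_add_right_eq_self (μ := (volume : Measure (Torus d))) (fun y => mFourier k y)
    -- Translation by half a period in direction `j` changes the sign of the character but not its
    -- integral.
    (proj (Pi.single j (1 / (2 * (k j : ℝ)))))
  have hj' : (k j : ℂ) ≠ 0 := by exact_mod_cast hj
  have h2 : Complex.exp (2 * Real.pi * Complex.I *
      ∑ i, (k i : ℂ) * ((Pi.single j (1 / (2 * (k j : ℝ))) : Fin d → ℝ) i : ℝ)) = -1 := by
    rw [Finset.sum_eq_single j (fun i _ hi => by simp [hi]) (by simp), ← Complex.exp_pi_mul_I]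
    congr 1
    simp
    field_simp
  simp only [mFourier_add_proj, h2, mul_neg_one, integral_neg] at h1
  have h3 : (2 : ℂ) * ∫ y : Torus d, mFourier k y = 0 := by rw [two_mul]; nth_rw 1 [← h1]; simp
  simpa using h3

lemma integrable_continuousMap (f : C(Torus d, ℂ)) : Integrable f :=
  f.continuous.integrable_of_hasCompactSupport (HasCompactSupport.of_compactSpace _)

lemma integral_conj_mul_trigPoly (c : (Fin d → ℤ) →₀ ℂ) (k : Fin d → ℤ) :
    ∫ y : Torus d, mFourier (-k) y * trigPoly c y = c k := by
  simp only [trigPoly_apply, Finset.mul_sum]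
  have h : ∀ l ∈ c.support, Integrable fun y : Torus d => mFourier (-k) y * (c l * mFourier l y) :=
    fun l _ => integrable_continuousMap (mFourier (-k) * (c l • mFourier l))
  rw [integral_finsetSum _ h]
  have h2 : ∀ l, ∫ y : Torus d, mFourier (-k) y * (c l * mFourier l y) =
      if l = k then c l else 0 := by
    intro l
    have : ∀ y : Torus d, mFourier (-k) y * (c l * mFourier l y) = c l * mFourier (-k + l) y := by
      intro y; rw [mFourier_add]; ring
    simp only [this, integral_const_mul]
    split_ifs with hl
    · simp [hl, mFourier_zero]
    · rw [integral_mFourier (fun h => hl (by rwa [neg_add_eq_zero, eq_comm] at h)), mul_zero]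
  simp only [h2, Finset.sum_ite_eq', Finsupp.mem_support_iff]
  split_ifs with h
  · rfl
  · exact (not_not.mp h).symm

lemma norm_coeff_le (c : (Fin d → ℤ) →₀ ℂ) (k : Fin d → ℤ) : ‖c k‖ ≤ ‖trigPoly c‖ := by
  rw [← integral_conj_mul_trigPoly c k]
  refine (norm_integral_le_of_norm_le_const (C := ‖trigPoly c‖) (ae_of_all _ fun y => ?_)).trans
    (by simp)
  calc _ ≤ ‖(mFourier (-k) : C(Torus d, ℂ))‖ * ‖trigPoly c‖ := by
        rw [norm_mul]
        gcongr <;> exact ContinuousMap.norm_coe_le_norm _ _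
    _ = _ := by rw [mFourier_norm, one_mul]

/-- The resolvent of `A : D²` is a contraction on trigonometric polynomials. -/
lemma norm_trigPoly_le {A : Matrix (Fin d) (Fin d) ℝ} (hA : A.PosSemidef) {ε : ℝ} (hε : 0 ≤ ε)
    (c : (Fin d → ℤ) →₀ ℂ) :
    ‖trigPoly c‖ ≤ ‖trigPoly ((fun k : Fin d → ℤ => (1 + ε * symbol A k : ℂ)) • c)‖ := by
  refine (ContinuousMap.norm_le _ (norm_nonneg _)).mpr fun y => ?_
  -- A rotation by `θ` makes the value at `y` real and nonnegative. At a maximum `y₀` of the rotated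
  -- real part `w`, `A : D²w ≤ 0`, so `w - ε A : D²w` is at least `w` there.
  obtain ⟨θ, hθ, hθy⟩ := RCLike.exists_norm_eq_mul_self (trigPoly c y)
  set w : Torus d → ℝ := fun y => (trigPoly (θ • c) y).re with hw
  have hwc : Continuous w := Complex.continuous_re.comp (trigPoly (θ • c)).continuous
  obtain ⟨y₀, -, hy₀⟩ := isCompact_univ.exists_isMaxOn ⟨y, mem_univ y⟩ hwc.continuousOn
  have hmax : ∀ z, w z ≤ w y₀ := fun z => hy₀ (mem_univ z)
  have h1 : frob A (torusHess w y₀) ≤ 0 := by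
    refine frob_hess_nonpos hA ?_ (Eventually.of_forall fun v => ?_)
    · exact_mod_cast contDiff_re_trigPoly (θ • c) y₀ 2
    · simpa [proj_zero] using hmax (y₀ + proj v)
  rw [frob_torusHess_re_trigPoly, neg_nonpos] at h1
  have h2 : θ • ((fun k : Fin d → ℤ => (1 + ε * symbol A k : ℂ)) • c) =
      θ • c + (ε : ℂ) • ((fun k : Fin d → ℤ => (symbol A k : ℂ)) • (θ • c)) := by
    ext k
    simp
    ring
  have h3 : (trigPoly (θ • ((fun k : Fin d → ℤ => (1 + ε * symbol A k : ℂ)) • c)) y₀).re =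
      w y₀ + ε * (trigPoly ((fun k : Fin d → ℤ => (symbol A k : ℂ)) • (θ • c)) y₀).re := by
    rw [h2, map_add, map_smul _ (ε : ℂ), ContinuousMap.add_apply, ContinuousMap.smul_apply,
      smul_eq_mul, Complex.add_re, Complex.re_ofReal_mul]
  calc ‖trigPoly c y‖ = w y := by
        simp only [hw, map_smul, ContinuousMap.smul_apply, smul_eq_mul, ← hθy]
        exact (Complex.ofReal_re _).symm
    _ ≤ w y₀ := hmax y
    _ ≤ (trigPoly (θ • ((fun k : Fin d → ℤ => (1 + ε * symbol A k : ℂ)) • c)) y₀).re := by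
        rw [h3]; nlinarith
    _ ≤ ‖trigPoly (θ • ((fun k : Fin d → ℤ => (1 + ε * symbol A k : ℂ)) • c))‖ :=
        (Complex.re_le_norm _).trans (ContinuousMap.norm_coe_le_norm _ _)
    _ = _ := by rw [map_smul, norm_smul, hθ, one_mul]

/-- The Fourier multiplier of the resolvent `(1 - ε A : D²)⁻¹`. -/
def resolvent (A : Matrix (Fin d) (Fin d) ℝ) (ε : ℝ) (k : Fin d → ℤ) : ℂ :=
  (1 + ε * symbol A k : ℂ)⁻¹

lemma one_add_symbol_ne_zero {A : Matrix (Fin d) (Fin d) ℝ} (hA : A.PosSemidef) {ε : ℝ}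
    (hε : 0 ≤ ε) (k : Fin d → ℤ) : (1 + ε * symbol A k : ℂ) ≠ 0 := by
  have : 0 < 1 + ε * symbol A k := by have := symbol_nonneg hA k; positivity
  exact_mod_cast this.ne'

lemma norm_trigPoly_resolvent_pow_le {A : Matrix (Fin d) (Fin d) ℝ} (hA : A.PosSemidef) {ε : ℝ}
    (hε : 0 ≤ ε) (n : ℕ) (c : (Fin d → ℤ) →₀ ℂ) :
    ‖trigPoly (resolvent A ε ^ n • c)‖ ≤ ‖trigPoly c‖ := by
  induction n with
  | zero => simp
  | succ n ih =>
    refine (norm_trigPoly_le hA hε _).trans (le_of_eq_of_le ?_ ih)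
    congr 2
    ext k
    have := one_add_symbol_ne_zero hA hε k
    simp only [resolvent, pow_succ, Finsupp.coe_pointwise_smul, Pi.smul_apply', Pi.mul_apply,
      Pi.pow_apply, smul_eq_mul]
    field_simp

/-- Telescoping: `Rⁿ - Rⁿ⁺¹ = ε Rⁿ⁺¹ (-A : D²)`, and every power of `R` is a contraction. -/
lemma norm_trigPoly_sub_resolvent_pow_le {A : Matrix (Fin d) (Fin d) ℝ} (hA : A.PosSemidef)
    {ε : ℝ} (hε : 0 ≤ ε) (n : ℕ) (c : (Fin d → ℤ) →₀ ℂ) :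
    ‖trigPoly c - trigPoly (resolvent A ε ^ n • c)‖ ≤
      n * ε * ‖trigPoly ((fun k : Fin d → ℤ => (symbol A k : ℂ)) • c)‖ := by
  induction n with
  | zero => simp
  | succ n ih =>
    have h1 : trigPoly (resolvent A ε ^ n • c) - trigPoly (resolvent A ε ^ (n + 1) • c) =
        (ε : ℂ) • trigPoly (resolvent A ε ^ (n + 1) •
          ((fun k : Fin d → ℤ => (symbol A k : ℂ)) • c)) := by
      rw [← map_sub, ← map_smul]
      congr 1
      ext k
      have := one_add_symbol_ne_zero hA hε k
      simp only [resolvent, pow_succ, Finsupp.coe_pointwise_smul, Pi.smul_apply', Pi.mul_apply,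
        Pi.pow_apply, smul_eq_mul, Finsupp.sub_apply, Finsupp.smul_apply]
      field_simp
      ring
    have h2 := norm_trigPoly_resolvent_pow_le hA hε (n + 1)
      ((fun k : Fin d → ℤ => (symbol A k : ℂ)) • c)
    calc _ = ‖(trigPoly c - trigPoly (resolvent A ε ^ n • c)) +
          (ε : ℂ) • trigPoly (resolvent A ε ^ (n + 1) •
          ((fun k : Fin d → ℤ => (symbol A k : ℂ)) • c))‖ := by rw [← h1]; congr 1; abel
      _ ≤ n * ε * ‖trigPoly ((fun k : Fin d → ℤ => (symbol A k : ℂ)) • c)‖ +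
          ε * ‖trigPoly ((fun k : Fin d → ℤ => (symbol A k : ℂ)) • c)‖ := by
        refine (norm_add_le _ _).trans (add_le_add ih ?_)
        rw [norm_smul, Complex.norm_real, Real.norm_of_nonneg hε]
        gcongr
      _ = _ := by push_cast; ring

lemma summable_inv_one_add_sq : Summable fun k : ℤ => (1 + (k : ℝ) ^ 2)⁻¹ := by
  have h1 : Summable fun k : ℤ => 1 / (k : ℝ) ^ 2 + if k = 0 then 1 else 0 :=
    (Real.summable_one_div_int_pow.mpr one_lt_two).add
      (summable_of_hasFiniteSupport ((finite_singleton (0 : ℤ)).subset fun k hk => by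
        by_contra h; simp_all))
  refine h1.of_nonneg_of_le (fun k => by positivity) fun k => ?_
  split_ifs with hk
  · simp [hk]
  · have : (k : ℝ) ≠ 0 := by exact_mod_cast hk
    rw [add_zero, one_div]
    gcongr
    linarith

lemma sum_prod_inv_one_add_sq_le (s : Finset (Fin d → ℤ)) (t : ℝ) (ht : 0 ≤ t) :
    ∑ k ∈ s, ∏ i, t * (1 + (k i : ℝ) ^ 2)⁻¹ ≤ (t * ∑' k : ℤ, (1 + (k : ℝ) ^ 2)⁻¹) ^ d := by
  classical
  have hs : s ⊆ Fintype.piFinset fun i => s.image fun k => k i := fun k hk => by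
    simp only [Fintype.mem_piFinset, Finset.mem_image]
    exact fun i => ⟨k, hk, rfl⟩
  refine (Finset.sum_le_sum_of_subset_of_nonneg hs fun k _ _ => by positivity).trans ?_
  rw [← Finset.prod_univ_sum (fun i : Fin d => s.image fun k => k i)
    (fun _ (l : ℤ) => t * (1 + (l : ℝ) ^ 2)⁻¹)]
  refine (Finset.prod_le_prod (fun i _ => by positivity) fun i _ => ?_).trans_eq
    (by rw [Finset.prod_const, Finset.card_univ, Fintype.card_fin])
  rw [← Finset.mul_sum]
  gcongr
  exact summable_inv_one_add_sq.sum_le_tsum _ fun _ _ => by positivity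

/-- A priori bound in the supremum norm for `A : D² u = f` on the torus. -/
lemma exists_norm_trigPoly_le {A : Matrix (Fin d) (Fin d) ℝ} (hA : A.PosDef) :
    ∃ C : ℝ, ∀ c : (Fin d → ℤ) →₀ ℂ, c 0 = 0 →
      ‖trigPoly c‖ ≤ C * ‖trigPoly ((fun k : Fin d → ℤ => (symbol A k : ℂ)) • c)‖ := by
  obtain rfl | hd := d.eq_zero_or_pos
  · refine ⟨0, fun c hc => ?_⟩
    have : c = 0 := Finsupp.ext fun k => by rw [Subsingleton.elim k 0, hc]; rfl
    simp [this]
  obtain ⟨l, hl, hlk⟩ := exists_symbol_ge hA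
  set B := ∑' k : ℤ, (1 + (k : ℝ) ^ 2)⁻¹ with hB
  have hBpos : 0 < B := summable_inv_one_add_sq.tsum_pos (fun _ => by positivity) 0 (by simp)
  -- With `t B = 1/2` and `ε l = 1/t`, each resolvent multiplier at `k ≠ 0` is at most `t (1 +
  -- k_i²)⁻¹` for every `i`. Using one coordinate per factor of `R^d`, the multipliers sum to at
  -- most `(1/2)^d ≤ 1/2`.
  set t := 1 / (2 * B) with ht
  have htpos : 0 < t := by positivity
  set ε := 1 / (l * t) with hεdef
  have hε : 0 < ε := by positivity
  refine ⟨2 * (d * ε), fun c hc => ?_⟩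
  have hr : ∀ k ∈ c.support, ‖(resolvent A ε ^ d • c) k • (mFourier k : C(Torus d, ℂ))‖ ≤
      (∏ i, t * (1 + (k i : ℝ) ^ 2)⁻¹) * ‖trigPoly c‖ := by
    intro k hk
    have hk0 : k ≠ 0 := by rintro rfl; exact (Finsupp.mem_support_iff.mp hk) hc
    rw [norm_smul, mFourier_norm, mul_one, Finsupp.coe_pointwise_smul, Pi.smul_apply',
      smul_eq_mul, norm_mul, Pi.pow_apply, norm_pow]
    refine mul_le_mul ?_ (norm_coeff_le c k) (norm_nonneg _) (by positivity)
    have : ‖resolvent A ε k‖ ^ d = ∏ _i : Fin d, ‖resolvent A ε k‖ := by simp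
    rw [this]
    refine Finset.prod_le_prod (fun _ _ => norm_nonneg _) fun i _ => ?_
    have h0 := symbol_nonneg hA.posSemidef k
    have h1 : ‖resolvent A ε k‖ = (1 + ε * symbol A k)⁻¹ := by
      have : resolvent A ε k = (((1 + ε * symbol A k)⁻¹ : ℝ) : ℂ) := by simp [resolvent]
      rw [this, Complex.norm_real, Real.norm_of_nonneg (by positivity)]
    rw [h1, ← inv_inv t, ← mul_inv]
    gcongr
    calc t⁻¹ * (1 + (k i : ℝ) ^ 2) = ε * (l * (1 + (k i : ℝ) ^ 2)) := by
          rw [hεdef]; field_simp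
      _ ≤ ε * symbol A k := by gcongr; exact hlk k i hk0
      _ ≤ _ := by linarith
  have h1 : ‖trigPoly (resolvent A ε ^ d • c)‖ ≤ 1 / 2 * ‖trigPoly c‖ := by
    have h2 : trigPoly (resolvent A ε ^ d • c) =
        ∑ k ∈ c.support, (resolvent A ε ^ d • c) k • (mFourier k : C(Torus d, ℂ)) := by
      ext y
      rw [trigPoly_smul_apply]
      simp
    rw [h2]
    refine (norm_sum_le_of_le _ hr).trans ?_
    rw [← Finset.sum_mul]
    gcongr
    refine (sum_prod_inv_one_add_sq_le _ t htpos.le).trans ?_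
    have h3 : t * B = 1 / 2 := by rw [ht]; field_simp
    rw [← hB, h3]
    exact (pow_le_pow_of_le_one (by norm_num) (by norm_num) hd).trans_eq (pow_one _)
  have h2 := norm_trigPoly_sub_resolvent_pow_le hA.posSemidef hε.le d c
  have h3 := norm_sub_norm_le (trigPoly c) (trigPoly (resolvent A ε ^ d • c))
  linarith

/-! ### Solving `A : D²u = f` by approximation. -/

/-- Trigonometric polynomials are dense. As `f` has mean zero, removing the constant coefficient
costs no more than the approximation error, so density is used with `δ/2`. -/
lemma exists_trigPoly_near {f : C(Torus d, ℂ)} (hf : ∫ y, f y = 0) {δ : ℝ} (hδ : 0 < δ) :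
    ∃ p : (Fin d → ℤ) →₀ ℂ, p 0 = 0 ∧ ‖trigPoly p - f‖ < δ := by
  have h1 : f ∈ closure (Submodule.span ℂ (range (mFourier (d := Fin d))) : Set C(Torus d, ℂ)) := by
    have := span_mFourier_closure_eq_top (d := Fin d)
    rw [← Submodule.topologicalClosure_coe, this]
    trivial
  obtain ⟨g, hg, hfg⟩ := Metric.mem_closure_iff.mp h1 (δ / 2) (half_pos hδ)
  obtain ⟨p, rfl⟩ := (Finsupp.mem_span_range_iff_exists_finsupp).mp hg
  change dist f (trigPoly p) < δ / 2 at hfg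
  rw [dist_comm, dist_eq_norm] at hfg
  have h2 : ‖p 0‖ ≤ ‖trigPoly p - f‖ := by
    have h3 : p 0 = ∫ y, (trigPoly p - f) y := by
      have := integral_conj_mul_trigPoly p 0
      simp only [neg_zero, mFourier_zero, ContinuousMap.one_apply, one_mul] at this
      simp only [ContinuousMap.sub_apply]
      rw [integral_sub (integrable_continuousMap _) (integrable_continuousMap _), this, hf,
        sub_zero]
    rw [h3]
    refine (norm_integral_le_of_norm_le_const (C := ‖trigPoly p - f‖)
      (ae_of_all _ fun y => ContinuousMap.norm_coe_le_norm _ y)).trans (by simp)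
  refine ⟨p - Finsupp.single 0 (p 0), by simp, ?_⟩
  have h3 : trigPoly (p - Finsupp.single 0 (p 0)) - f =
      (trigPoly p - f) - p 0 • mFourier 0 := by
    rw [map_sub, trigPoly, Finsupp.linearCombination_single]; abel
  rw [h3]
  refine (norm_sub_le _ _).trans_lt ?_
  rw [norm_smul, mFourier_norm]
  linarith

/-- `u` is a uniform limit of classical solutions of `A : D² w = g` with `g` tending to `f`
uniformly. -/
def IsApproxSolution (A : Matrix (Fin d) (Fin d) ℝ) (f u : Torus d → ℝ) : Prop :=
  ∀ δ > 0, ∃ w : Torus d → ℝ, IsC2 w ∧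
    (∀ y, |w y - u y| ≤ δ) ∧ ∀ y, |frob A (torusHess w y) - f y| ≤ δ

/-- For continuous `f` of mean zero, `A : D² u = f` is solvable as a limit of classical solutions
with uniformly converging data. -/
lemma exists_approx_solution {A : Matrix (Fin d) (Fin d) ℝ} (hA : A.PosDef) {f : Torus d → ℝ}
    (hf : Continuous f) (hf0 : ∫ y, f y = 0) :
    ∃ u : Torus d → ℝ, Continuous u ∧ IsApproxSolution A f u := by
  obtain ⟨C, hC⟩ := exists_norm_trigPoly_le hA
  obtain ⟨l, hl, hlk⟩ := exists_symbol_ge hA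
  set F : C(Torus d, ℂ) := ⟨fun y => -(f y : ℂ), by fun_prop⟩ with hF
  have hF0 : ∫ y, F y = 0 := by
    simp only [hF, ContinuousMap.coe_mk, integral_neg, integral_complex_ofReal, hf0]
    simp
  choose p hp0 hpF using fun n : ℕ => exists_trigPoly_near hF0 (Nat.one_div_pos_of_nat (n := n))
  have hpt : Tendsto (fun n => trigPoly (p n)) atTop (𝓝 F) := by
    rw [tendsto_iff_norm_sub_tendsto_zero]
    exact squeeze_zero (fun _ => norm_nonneg _) (fun n => (hpF n).le)
      tendsto_one_div_add_atTop_nhds_zero_nat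
  -- Division by the symbol is harmless at frequency zero, where the symbol vanishes, because `p n 0
  -- = 0`.
  set c : ℕ → ((Fin d → ℤ) →₀ ℂ) := fun n => (fun k => (symbol A k : ℂ)⁻¹) • p n with hc
  have hc0 : ∀ n, c n 0 = 0 := fun n => by simp [hc, hp0]
  have hcp : ∀ n, (fun k : Fin d → ℤ => (symbol A k : ℂ)) • c n = p n := by
    intro n
    ext k
    by_cases hk : k = 0
    · simp [hk, hc, hp0]
    · obtain ⟨i, -⟩ := Function.ne_iff.mp hk
      have h1 : 0 < symbol A k := lt_of_lt_of_le (by positivity) (hlk k i hk)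
      have h2 : (symbol A k : ℂ) ≠ 0 := by exact_mod_cast h1.ne'
      simp [hc, h2]
  have hcauchy : CauchySeq fun n => trigPoly (c n) := by
    have h1 : ∀ m n, dist (trigPoly (c m)) (trigPoly (c n)) ≤
        C * dist (trigPoly (p m)) (trigPoly (p n)) := by
      intro m n
      rw [dist_eq_norm, dist_eq_norm, ← map_sub, ← map_sub]
      have := hC (c m - c n) (by simp [hc0])
      have h2 : (fun k : Fin d → ℤ => (symbol A k : ℂ)) • (c m - c n) = p m - p n := by
        conv_rhs => rw [← hcp m, ← hcp n]
        ext k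
        simp [mul_sub]
      rwa [h2] at this
    rw [cauchySeq_iff_tendsto_dist_atTop_0]
    refine squeeze_zero (fun _ => dist_nonneg) (fun n => h1 n.1 n.2) ?_
    simpa using (cauchySeq_iff_tendsto_dist_atTop_0.mp hpt.cauchySeq).const_mul C
  obtain ⟨U, hU⟩ := cauchySeq_tendsto_of_complete hcauchy
  refine ⟨fun y => (U y).re, Complex.continuous_re.comp U.continuous, fun δ hδ => ?_⟩
  obtain ⟨n, hn1, hn2⟩ := ((Metric.tendsto_nhds.mp hU δ hδ).and
    (Metric.tendsto_nhds.mp hpt δ hδ)).exists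
  refine ⟨fun y => (trigPoly (c n) y).re, isC2_re_trigPoly _, fun y => ?_, fun y => ?_⟩
  · rw [← Complex.sub_re]
    refine (Complex.abs_re_le_norm _).trans ?_
    rw [dist_eq_norm] at hn1
    exact (ContinuousMap.norm_coe_le_norm (trigPoly (c n) - U) y).trans hn1.le
  · rw [frob_torusHess_re_trigPoly, hcp]
    rw [dist_eq_norm] at hn2
    have h1 : -(trigPoly (p n) y).re - f y = -((trigPoly (p n) - F) y).re := by
      simp [hF]; ring
    rw [h1, abs_neg]
    exact (Complex.abs_re_le_norm _).trans
      ((ContinuousMap.norm_coe_le_norm (trigPoly (p n) - F) y).trans hn2.le)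

/-! ### Hessian calculus and stability of viscosity inequalities. -/

lemma frob_add (A B C : Matrix (Fin d) (Fin d) ℝ) : frob A (B + C) = frob A B + frob A C := by
  simp [frob, mul_add, Finset.sum_add_distrib]

lemma frob_smul (A : Matrix (Fin d) (Fin d) ℝ) (r : ℝ) (B : Matrix (Fin d) (Fin d) ℝ) :
    frob A (r • B) = r * frob A B := by
  simp only [frob, Matrix.smul_apply, smul_eq_mul, Finset.mul_sum]
  refine Finset.sum_congr rfl fun i _ => Finset.sum_congr rfl fun j _ => ?_
  ring

lemma smul_frob (A : Matrix (Fin d) (Fin d) ℝ) (r : ℝ) (B : Matrix (Fin d) (Fin d) ℝ) :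
    frob (r • A) B = r * frob A B := by
  simp only [frob, Matrix.smul_apply, smul_eq_mul, Finset.mul_sum, mul_assoc]

lemma differentiable_fderiv_of_contDiff_two {φ : (Fin d → ℝ) → ℝ} (hφ : ContDiff ℝ 2 φ) :
    Differentiable ℝ (fderiv ℝ φ) :=
  (hφ.fderiv_right (m := 1) (by norm_num)).differentiable (by norm_num)

lemma hess_add {φ ψ : (Fin d → ℝ) → ℝ} (hφ : ContDiff ℝ 2 φ) (hψ : ContDiff ℝ 2 ψ)
    (x : Fin d → ℝ) : hess (fun v => φ v + ψ v) x = hess φ x + hess ψ x := by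
  have h1 : fderiv ℝ (fun v => φ v + ψ v) = fun v => fderiv ℝ φ v + fderiv ℝ ψ v :=
    funext fun v => fderiv_fun_add (hφ.differentiable (by norm_num) v)
      (hψ.differentiable (by norm_num) v)
  ext i j
  rw [hess, h1, fderiv_fun_add (differentiable_fderiv_of_contDiff_two hφ x)
    (differentiable_fderiv_of_contDiff_two hψ x)]
  rfl

lemma hess_smul (r : ℝ) {φ : (Fin d → ℝ) → ℝ} (hφ : ContDiff ℝ 2 φ) (x : Fin d → ℝ) :
    hess (fun v => r * φ v) x = r • hess φ x := by
  have h1 : fderiv ℝ (fun v => r * φ v) = fun v => r • fderiv ℝ φ v :=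
    funext fun v => fderiv_const_mul (hφ.differentiable (by norm_num) v) r
  ext i j
  rw [hess, h1, fderiv_fun_const_smul (differentiable_fderiv_of_contDiff_two hφ x)]
  rfl

lemma hess_comp_add_left (φ : (Fin d → ℝ) → ℝ) (a x : Fin d → ℝ) :
    hess (fun v => φ (a + v)) x = hess φ (a + x) := by
  have h1 : fderiv ℝ (fun v => φ (a + v)) = fun v => fderiv ℝ φ (a + v) :=
    funext fun v => fderiv_comp_add_left a
  ext i j
  rw [hess, h1, fderiv_comp_add_left]
  rfl

lemma continuous_hess {φ : (Fin d → ℝ) → ℝ} (hφ : ContDiff ℝ 2 φ) (i j : Fin d) :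
    Continuous fun x => hess φ x i j := by
  have h1 : Continuous (fderiv ℝ (fderiv ℝ φ)) :=
    (hφ.fderiv_right (m := 1) (by norm_num)).continuous_fderiv (by norm_num)
  exact (h1.clm_apply continuous_const).clm_apply continuous_const

lemma continuous_frob_hess (A : Matrix (Fin d) (Fin d) ℝ) {φ : (Fin d → ℝ) → ℝ}
    (hφ : ContDiff ℝ 2 φ) : Continuous fun x => frob A (hess φ x) :=
  continuous_finsetSum _ fun i _ => continuous_finsetSum _ fun j _ =>
    continuous_const.mul (continuous_hess hφ i j)

lemma torusHess_proj (φ : Torus d → ℝ) (v : Fin d → ℝ) :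
    torusHess φ (proj v) = hess (fun v => φ (proj v)) v := by
  have := hess_comp_add_left (fun v => φ (proj v)) v 0
  simpa only [torusHess, proj_add, add_zero] using this

lemma IsC2.contDiff_add {w : Torus d → ℝ} (hw : IsC2 w) (y : Torus d) :
    ContDiff ℝ 2 fun v => w (y + proj v) := by
  obtain ⟨a, rfl⟩ := proj_surjective y
  simp only [← proj_add]
  have h : ContDiff ℝ 2 fun v => w (proj v) := hw
  exact h.comp (contDiff_const.add contDiff_id)

lemma IsC2.continuous {w : Torus d → ℝ} (hw : IsC2 w) : Continuous w := by
  exact isQuotientMap_proj.continuous_iff.mpr (ContDiff.continuous hw)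

lemma hess_add_proj (w : Torus d → ℝ) (y : Torus d) (v : Fin d → ℝ) :
    hess (fun v => w (y + proj v)) v = torusHess w (y + proj v) := by
  obtain ⟨a, rfl⟩ := proj_surjective y
  rw [← proj_add, torusHess_proj]
  simp only [← proj_add]
  exact hess_comp_add_left (fun v => w (proj v)) a v

lemma IsApproxSolution.neg {A : Matrix (Fin d) (Fin d) ℝ} {f u : Torus d → ℝ}
    (h : IsApproxSolution A f u) : IsApproxSolution A (fun y => -f y) (fun y => -u y) := by
  intro δ hδ
  obtain ⟨w, hw, h1, h2⟩ := h δ hδ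
  refine ⟨fun y => -w y, ContDiff.neg hw, fun y => ?_, fun y => ?_⟩
  · rw [← abs_neg]; convert h1 y using 2; ring
  · have h3 : torusHess (fun y => -w y) y = (-1 : ℝ) • torusHess w y := by
      rw [torusHess, torusHess, ← hess_smul _ (hw.contDiff_add y)]
      simp
    rw [h3, frob_smul, ← abs_neg]; convert h2 y using 2; ring

/-- Stability of viscosity subsolutions under uniform limits. -/
lemma IsApproxSolution.le_frob_hess {A : Matrix (Fin d) (Fin d) ℝ} (hA : A.PosSemidef)
    {f u : Torus d → ℝ} (hf : Continuous f) (h : IsApproxSolution A f u)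
    {y : Torus d} {φ : (Fin d → ℝ) → ℝ} (hφ : ContDiff ℝ 2 φ)
    (hmax : IsLocalMax (fun v => u (y + proj v) - φ v) 0) : f y ≤ frob A (hess φ 0) := by
  by_contra! hlt
  obtain ⟨η, hη, hηlt⟩ : ∃ η > 0, frob A (hess φ 0) + 2 * η < f y :=
    ⟨(f y - frob A (hess φ 0)) / 4, by linarith, by linarith⟩
  -- A smooth quadratic penalty dominating the squared sup norm. Adding `ε N` to `φ` makes the
  -- maximum strict, and `ε = η / M` keeps the change in `A : D²φ` below `η`.
  set N : (Fin d → ℝ) → ℝ := fun v => ∑ i, v i ^ 2 with hN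
  have hNs : ContDiff ℝ 2 N := by fun_prop
  have hNge : ∀ v, ‖v‖ ^ 2 ≤ N v := by
    intro v
    refine (Real.le_sqrt (norm_nonneg _) (Finset.sum_nonneg fun i _ => sq_nonneg _)).mp ?_
    refine (pi_norm_le_iff_of_nonneg (Real.sqrt_nonneg _)).mpr fun i => Real.le_sqrt_of_sq_le ?_
    rw [Real.norm_eq_abs, sq_abs]
    exact Finset.single_le_sum (f := fun i => v i ^ 2) (fun i _ => sq_nonneg _) (Finset.mem_univ i)
  set M := |frob A (hess N 0)| + 1 with hM
  have hMpos : 0 < M := by positivity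
  set ε := η / M with hε
  have hεpos : 0 < ε := by positivity
  have hev : ∀ᶠ v in 𝓝 (0 : Fin d → ℝ), (u (y + proj v) - φ v ≤ u (y + proj 0) - φ 0) ∧
      frob A (hess N v) < M ∧ frob A (hess φ v) + 2 * η < f (y + proj v) := by
    refine hmax.and (Filter.Eventually.and ?_ ?_)
    · refine (continuous_frob_hess A hNs).continuousAt.eventually_lt continuousAt_const ?_
      have := le_abs_self (frob A (hess N 0))
      linarith
    · refine ContinuousAt.eventually_lt
        ((continuous_frob_hess A hφ).add continuous_const).continuousAt
        (hf.comp (continuous_const.add continuous_proj)).continuousAt ?_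
      simpa [proj_zero] using hηlt
  obtain ⟨r, hr, hball⟩ := Metric.nhds_basis_closedBall.eventually_iff.mp hev
  -- Replacing `u` by `w` at two points costs at most `ε r²/2`, less than the penalty `ε r²` on the
  -- boundary sphere, so the maximum of the perturbed function stays interior.
  obtain ⟨w, hw, hwu, hwf⟩ := h (min η (ε * r ^ 2 / 4)) (by positivity)
  set ψ : (Fin d → ℝ) → ℝ := fun v => w (y + proj v) + (-1) * (φ v + ε * N v) with hψ
  have hφN : ContDiff ℝ 2 fun v => φ v + ε * N v := hφ.add (contDiff_const.mul hNs)
  have hψs : ContDiff ℝ 2 ψ := (hw.contDiff_add y).add (contDiff_const.mul hφN)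
  obtain ⟨x, hx, hxmax⟩ := (isCompact_closedBall (0 : Fin d → ℝ) r).exists_isMaxOn
    ⟨0, Metric.mem_closedBall_self hr.le⟩ hψs.continuous.continuousOn
  have hxball : x ∈ Metric.ball 0 r := by
    by_contra hnot
    have hnorm : r ≤ ‖x‖ := by simpa using hnot
    have h0 := isMaxOn_iff.mp hxmax 0 (Metric.mem_closedBall_self hr.le)
    have h1 := (hball hx).1
    have h2 := abs_le.mp ((hwu (y + proj x)).trans (min_le_right _ _))
    have h3 := abs_le.mp ((hwu (y + proj 0)).trans (min_le_right _ _))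
    have h4 : ε * r ^ 2 ≤ ε * N x := by
      gcongr
      exact le_trans (by gcongr) (hNge x)
    have h5 : N 0 = 0 := by simp [hN]
    have h6 : 0 < ε * r ^ 2 := by positivity
    simp only [hψ, h5] at h0
    linarith [h2.2, h3.1]
  have hloc : IsLocalMax ψ x :=
    hxmax.isLocalMax (Filter.mem_of_superset (Metric.isOpen_ball.mem_nhds hxball)
      Metric.ball_subset_closedBall)
  have h1 := frob_hess_nonpos hA hψs hloc
  rw [hψ, hess_add (hw.contDiff_add y) (contDiff_const.mul hφN), hess_smul _ hφN,
    hess_add hφ (contDiff_const.mul hNs), hess_smul _ hNs, hess_add_proj, frob_add, frob_smul,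
    frob_add, frob_smul] at h1
  have h2 := abs_le.mp ((hwf (y + proj x)).trans (min_le_left _ _))
  have h3 := (hball hx).2
  have h4 : ε * frob A (hess N x) ≤ η := by
    calc ε * frob A (hess N x) ≤ ε * M := by gcongr; exact h3.1.le
      _ = η := by rw [hε]; field_simp
  linarith [h2.1, h3.2]

/-- Stability of viscosity supersolutions under uniform limits. -/
lemma IsApproxSolution.frob_hess_le {A : Matrix (Fin d) (Fin d) ℝ} (hA : A.PosSemidef)
    {f u : Torus d → ℝ} (hf : Continuous f) (h : IsApproxSolution A f u)
    {y : Torus d} {φ : (Fin d → ℝ) → ℝ} (hφ : ContDiff ℝ 2 φ)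
    (hmin : IsLocalMin (fun v => u (y + proj v) - φ v) 0) : frob A (hess φ 0) ≤ f y := by
  have h1 := h.neg.le_frob_hess hA hf.neg (y := y) (φ := fun v => (-1) * φ v)
    (contDiff_const.mul hφ) (by
      filter_upwards [hmin] with v hv
      linarith)
  rw [hess_smul _ hφ, frob_smul, Pi.neg_apply] at h1
  linarith

/-! ### Inverting the operator and solving the cell problem. -/

/-- The solution `s` of `max (-(a * s)) (-(b * s)) = k` for `0 < a ≤ b`. -/
def maxOpInv (a b k : ℝ) : ℝ := if k ≤ 0 then -k / a else -k / b

/-- For `k ≤ 0` the solution is nonnegative and the coefficient `a` is active; for `k > 0` it is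
negative and `b` is active. One-sided equivalences are needed because sub- and supersolutions give
only inequalities. -/
lemma max_le_iff_maxOpInv_le {a b : ℝ} (ha : 0 < a) (hab : a ≤ b) (k s : ℝ) :
    max (-(a * s)) (-(b * s)) ≤ k ↔ maxOpInv a b k ≤ s := by
  have hb : 0 < b := ha.trans_le hab
  rw [max_le_iff, maxOpInv]
  split_ifs with hk
  · rw [div_le_iff₀ ha]
    refine ⟨fun h => by linarith [h.1], fun h => ?_⟩
    have : 0 ≤ s := by by_contra! hs; nlinarith
    constructor <;> nlinarith
  · rw [div_le_iff₀ hb]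
    refine ⟨fun h => by linarith [h.2], fun h => ⟨?_, by linarith⟩⟩
    by_cases hs : 0 ≤ s <;> nlinarith

lemma le_max_iff_le_maxOpInv {a b : ℝ} (ha : 0 < a) (hab : a ≤ b) (k s : ℝ) :
    k ≤ max (-(a * s)) (-(b * s)) ↔ s ≤ maxOpInv a b k := by
  have hb : 0 < b := ha.trans_le hab
  rw [le_max_iff, maxOpInv]
  split_ifs with hk
  · rw [le_div_iff₀ ha]
    refine ⟨fun h => ?_, fun h => Or.inl (by linarith)⟩
    obtain h | h := h
    · linarith
    · by_cases hs : 0 ≤ s <;> nlinarith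
  · rw [le_div_iff₀ hb]
    refine ⟨fun h => ?_, fun h => Or.inr (by linarith)⟩
    obtain h | h := h
    · have : s < 0 := by by_contra! hs; nlinarith
      nlinarith
    · linarith

lemma integrable_of_continuous {f : Torus d → ℝ} (hf : Continuous f) (μ : Measure (Torus d))
    [IsFiniteMeasure μ] : Integrable f μ :=
  hf.integrable_of_hasCompactSupport (HasCompactSupport.of_compactSpace _)

lemma integral_inv_pos {b : Torus d → ℝ} (hb : Continuous b) (hpos : ∀ y, 0 < b y) :
    0 < ∫ y, (b y)⁻¹ := by
  refine (integral_pos_iff_support_of_nonneg (fun y => (inv_pos.mpr (hpos y)).le)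
    (integrable_of_continuous (hb.inv₀ fun y => (hpos y).ne') _)).mpr ?_
  have : Function.support (fun y => (b y)⁻¹) = univ := by
    ext y; simp [(hpos y).ne']
  rw [this]; simp

/-- The branch is fixed by the sign of `k` alone, so only `1/a` or only `1/b` is averaged; this is
where harmonic means enter. -/
lemma integral_maxOpInv (a b : Torus d → ℝ) (k : ℝ) :
    ∫ y, maxOpInv (a y) (b y) k = maxOpInv (harmonicMean a) (harmonicMean b) k := by
  simp only [maxOpInv]
  split_ifs
  · simp only [div_eq_mul_inv, integral_const_mul, harmonicMean, inv_inv]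
  · simp only [div_eq_mul_inv, integral_const_mul, harmonicMean, inv_inv]

lemma continuous_maxOpInv {a b : Torus d → ℝ} (ha : Continuous a) (hb : Continuous b)
    (hapos : ∀ y, 0 < a y) (hbpos : ∀ y, 0 < b y) (k : ℝ) :
    Continuous fun y => maxOpInv (a y) (b y) k := by
  simp only [maxOpInv]
  split_ifs
  · exact continuous_const.div ha fun y => (hapos y).ne'
  · exact continuous_const.div hb fun y => (hbpos y).ne'

lemma harmonicMean_le {a b : Torus d → ℝ} (ha : Integrable fun y => (a y)⁻¹)
    (hb : Integrable fun y => (b y)⁻¹) (hapos : ∀ y, 0 < a y) (hab : ∀ y, a y ≤ b y)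
    (hpos : 0 < ∫ y, (b y)⁻¹) : harmonicMean a ≤ harmonicMean b := by
  refine inv_anti₀ hpos (integral_mono hb ha fun y => ?_)
  exact inv_anti₀ (hapos y) (hab y)

lemma isCellValue_iff {a₀ a₁ : Torus d → ℝ} {A : Matrix (Fin d) (Fin d) ℝ} (h : ℝ)
    (ha₀ : Continuous a₀) (ha₁ : Continuous a₁)
    (ha₀_pos : ∀ y, 0 < a₀ y) (ha₁_pos : ∀ y, 0 < a₁ y) (hA : A.PosDef)
    (Q : Matrix (Fin d) (Fin d) ℝ) (c : ℝ) :
    IsCellValue (maxOp a₀ a₁ A h) Q c ↔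
      c = max (-(harmonicMean a₀ * frob A Q))
        (-(harmonicMean (fun y => a₀ y + a₁ y) * frob A Q)) + h := by
  have hb_pos : ∀ y, 0 < a₀ y + a₁ y := fun y => add_pos (ha₀_pos y) (ha₁_pos y)
  have hb : Continuous fun y => a₀ y + a₁ y := ha₀.add ha₁
  have hab : ∀ y, a₀ y ≤ a₀ y + a₁ y := fun y => by linarith [ha₁_pos y]
  have hm₀ : 0 < harmonicMean a₀ := inv_pos.mpr (integral_inv_pos ha₀ ha₀_pos)
  have hm : harmonicMean a₀ ≤ harmonicMean fun y => a₀ y + a₁ y :=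
    harmonicMean_le (integrable_of_continuous (ha₀.inv₀ fun y => (ha₀_pos y).ne') _)
      (integrable_of_continuous (hb.inv₀ fun y => (hb_pos y).ne') _) ha₀_pos hab
      (integral_inv_pos hb hb_pos)
  set g : Torus d → ℝ := fun y => maxOpInv (a₀ y) (a₀ y + a₁ y) (c - h) with hg
  have hgc : Continuous g := continuous_maxOpInv ha₀ hb ha₀_pos hb_pos _
  have hle : ∀ P y, maxOp a₀ a₁ A h P y ≤ c ↔ g y ≤ frob A P := fun P y => by
    rw [hg, ← max_le_iff_maxOpInv_le (ha₀_pos y) (hab y), maxOp, le_sub_iff_add_le]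
  have hge : ∀ P y, c ≤ maxOp a₀ a₁ A h P y ↔ frob A P ≤ g y := fun P y => by
    rw [hg, ← le_max_iff_le_maxOpInv (ha₀_pos y) (hab y), maxOp, sub_le_iff_le_add]
  have hformula : c = max (-(harmonicMean a₀ * frob A Q))
        (-(harmonicMean (fun y => a₀ y + a₁ y) * frob A Q)) + h ↔ ∫ y, g y = frob A Q := by
    rw [hg, integral_maxOpInv, le_antisymm_iff, le_antisymm_iff (b := frob A Q),
      ← max_le_iff_maxOpInv_le hm₀ hm, ← le_max_iff_le_maxOpInv hm₀ hm, le_sub_iff_add_le,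
      sub_le_iff_le_add, and_comm]
  rw [hformula]
  have hint : Integrable g := integrable_of_continuous hgc _
  constructor
  · rintro ⟨u, hu, hsub, hsup⟩
    set m := ∫ y, g y - frob A Q with hmdef
    have hmval : m = (∫ y, g y) - frob A Q := by
      rw [hmdef, integral_sub hint (integrable_const _)]; simp
    -- Subtracting the mean `m` makes the equation solvable. A classical approximate solution `w` is
    -- a test function for `u` at the extrema of `u - w`: the maximum gives `m ≤ δ`, the minimum `-δ
    -- ≤ m`.
    obtain ⟨u', -, hu'⟩ := exists_approx_solution hA (f := fun y => g y - frob A Q - m)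
      ((hgc.sub continuous_const).sub continuous_const) (by
        have hi : Integrable fun y => g y - frob A Q := hint.sub (integrable_const _)
        rw [integral_sub hi (integrable_const _), ← hmdef]; simp)
    have hδ : ∀ δ > 0, |m| ≤ δ := by
      intro δ hδ
      obtain ⟨w, hw, -, hwf⟩ := hu' δ hδ
      have hcont : Continuous fun y => u y - w y := hu.sub hw.continuous
      obtain ⟨y₁, -, hy₁⟩ := isCompact_univ.exists_isMaxOn ⟨0, mem_univ 0⟩ hcont.continuousOn
      obtain ⟨y₂, -, hy₂⟩ := isCompact_univ.exists_isMinOn ⟨0, mem_univ 0⟩ hcont.continuousOn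
      have h1 := hsub y₁ _ (hw.contDiff_add y₁) (Eventually.of_forall fun v => by
        simpa [proj_zero] using hy₁ (mem_univ (y₁ + proj v)))
      have h2 := hsup y₂ _ (hw.contDiff_add y₂) (Eventually.of_forall fun v => by
        simpa [proj_zero] using hy₂ (mem_univ (y₂ + proj v)))
      rw [hle, frob_add] at h1
      rw [hge, frob_add] at h2
      have h3 := (abs_le.mp (hwf y₁)).2
      have h4 := (abs_le.mp (hwf y₂)).1
      rw [torusHess] at h3 h4
      exact abs_le.mpr ⟨by linarith, by linarith⟩
    have : m = 0 := abs_nonpos_iff.mp (le_of_forall_pos_le_add fun δ h => by simpa using hδ δ h)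
    linarith
  · intro hQ
    obtain ⟨u, hu, hu'⟩ := exists_approx_solution hA (f := fun y => g y - frob A Q)
      (hgc.sub continuous_const) (by rw [integral_sub hint (integrable_const _), hQ]; simp)
    have hf : Continuous fun y => g y - frob A Q := hgc.sub continuous_const
    refine ⟨u, hu, fun y φ hφ hmax => ?_, fun y φ hφ hmin => ?_⟩
    · rw [hle, frob_add]
      linarith [hu'.le_frob_hess hA.posSemidef hf hφ hmax]
    · rw [hge, frob_add]
      linarith [hu'.frob_hess_le hA.posSemidef hf hφ hmin]

/-! ### Integrals of second derivatives over the torus. -/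

lemma IsC2.continuous_torusHess {φ : Torus d → ℝ} (hφ : IsC2 φ) (i j : Fin d) :
    Continuous fun y => torusHess φ y i j := by
  refine isQuotientMap_proj.continuous_iff.mpr ?_
  simp only [Function.comp_def, torusHess_proj]
  exact continuous_hess hφ i j

lemma IsC2.continuous_frob_torusHess {φ : Torus d → ℝ} (hφ : IsC2 φ)
    (A : Matrix (Fin d) (Fin d) ℝ) : Continuous fun y => frob A (torusHess φ y) :=
  continuous_finsetSum _ fun i _ => continuous_finsetSum _ fun j _ =>
    continuous_const.mul (hφ.continuous_torusHess i j)

/-- The integral over the torus of a directional derivative vanishes. -/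
lemma integral_eq_zero_of_hasDerivAt {g g' : Torus d → ℝ} (hg : Continuous g)
    (hg' : Continuous g') (e : Fin d → ℝ)
    (h : ∀ y (t : ℝ), HasDerivAt (fun t : ℝ => g (y + proj (t • e))) (g' (y + proj (t • e))) t) :
    ∫ y, g' y = 0 := by
  obtain ⟨C, hC⟩ := isCompact_univ.exists_bound_of_continuousOn hg'.continuousOn
  have hgt : ∀ t : ℝ, Continuous fun y => g (y + proj (t • e)) := fun t =>
    hg.comp (continuous_id.add continuous_const)
  have hgt' : ∀ t : ℝ, Continuous fun y => g' (y + proj (t • e)) := fun t =>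
    hg'.comp (continuous_id.add continuous_const)
  have h1 := (hasDerivAt_integral_of_dominated_loc_of_deriv_le (μ := (volume : Measure (Torus d)))
    (F := fun (t : ℝ) y => g (y + proj (t • e))) (F' := fun (t : ℝ) y => g' (y + proj (t • e)))
    (x₀ := 0) (bound := fun _ => C) Filter.univ_mem
    (Eventually.of_forall fun t => (hgt t).aestronglyMeasurable)
    (integrable_of_continuous (hgt 0) _) (hgt' 0).aestronglyMeasurable
    (ae_of_all _ fun y t _ => hC _ (mem_univ _)) (integrable_const _)
    (ae_of_all _ fun y t _ => h y t)).2
  -- By translation invariance the differentiated integral is constant in `t`.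
  simp only [zero_smul, proj_zero, add_zero, integral_add_right_eq_self g] at h1
  exact h1.unique (hasDerivAt_const _ _)

lemma IsC2.integral_torusHess {φ : Torus d → ℝ} (hφ : IsC2 φ) (i j : Fin d) :
    ∫ y, torusHess φ y i j = 0 := by
  set g : Torus d → ℝ := fun y =>
    fderiv ℝ (fun v => φ (y + proj v)) 0 (Pi.single j (1 : ℝ)) with hg
  have hgv : ∀ (y : Torus d) (v : Fin d → ℝ), g (y + proj v) =
      fderiv ℝ (fun v => φ (y + proj v)) v (Pi.single j (1 : ℝ)) := by
    intro y v
    have := fderiv_comp_add_left (𝕜 := ℝ) (f := fun v => φ (y + proj v)) (x := 0) v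
    simp only [proj_add, add_zero, ← add_assoc] at this
    simp only [hg, this]
  have hgc : Continuous g := by
    refine isQuotientMap_proj.continuous_iff.mpr ?_
    have h1 := hgv 0
    simp only [zero_add] at h1
    simp only [Function.comp_def, h1]
    exact (ContDiff.continuous_fderiv hφ (by norm_num)).clm_apply continuous_const
  refine integral_eq_zero_of_hasDerivAt hgc (hφ.continuous_torusHess i j) (Pi.single i (1 : ℝ))
    fun y t => ?_
  simp only [hgv, ← hess_add_proj φ y]
  have h1 := (differentiable_fderiv_of_contDiff_two (hφ.contDiff_add y)
    (t • (Pi.single i 1 : Fin d → ℝ))).hasFDerivAt.comp_hasDerivAt t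
    ((hasDerivAt_id t).smul_const (Pi.single i 1 : Fin d → ℝ))
  refine (h1.clm_apply (hasDerivAt_const t (Pi.single j (1 : ℝ) : Fin d → ℝ))).congr_deriv ?_
  rw [map_zero, add_zero, one_smul]
  rfl

lemma IsC2.integral_frob_torusHess {φ : Torus d → ℝ} (hφ : IsC2 φ)
    (A : Matrix (Fin d) (Fin d) ℝ) : ∫ y, frob A (torusHess φ y) = 0 := by
  have h1 : ∀ i j, Integrable fun y => A i j * torusHess φ y i j := fun i j =>
    (integrable_of_continuous (hφ.continuous_torusHess i j) _).const_mul _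
  simp only [frob]
  rw [integral_finsetSum _ fun i _ => integrable_finsetSum _ fun j _ => h1 i j]
  refine Finset.sum_eq_zero fun i _ => ?_
  rw [integral_finsetSum _ fun j _ => h1 i j]
  refine Finset.sum_eq_zero fun j _ => ?_
  rw [integral_const_mul, hφ.integral_torusHess, mul_zero]

/-! ### Invariant measures. -/

lemma integrable_inv_of_le {b : Torus d → ℝ} (hb : Measurable b) {m : ℝ} (hm : 0 < m)
    (hmb : ∀ y, m ≤ b y) : Integrable fun y => (b y)⁻¹ :=
  .of_bound hb.inv.aestronglyMeasurable m⁻¹ (ae_of_all _ fun y => by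
    rw [Real.norm_of_nonneg (inv_nonneg.mpr (hm.le.trans (hmb y)))]
    exact inv_anti₀ hm (hmb y))

lemma integral_inv_pos_of_le {b : Torus d → ℝ} (hb : Measurable b) {m : ℝ} (hm : 0 < m)
    (hmb : ∀ y, m ≤ b y) : 0 < ∫ y, (b y)⁻¹ := by
  have hpos : ∀ y, 0 < b y := fun y => hm.trans_le (hmb y)
  refine (integral_pos_iff_support_of_nonneg (fun y => (inv_pos.mpr (hpos y)).le)
    (integrable_inv_of_le hb hm hmb)).mpr ?_
  have : Function.support (fun y => (b y)⁻¹) = univ := by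
    ext y; simp [(hpos y).ne']
  rw [this]; simp

/-- The probability measure with density proportional to `b⁻¹`. -/
def invMeasure (b : Torus d → ℝ) : Measure (Torus d) :=
  volume.withDensity fun y => ENNReal.ofReal (harmonicMean b / b y)

lemma isProbabilityMeasure_withDensity_div {b : Torus d → ℝ} (hb : Measurable b) {m : ℝ}
    (hm : 0 < m) (hmb : ∀ y, m ≤ b y) (κ : ℝ) :
    IsProbabilityMeasure (volume.withDensity fun y => ENNReal.ofReal (κ / b y)) ↔
      κ = harmonicMean b := by
  have hpos : ∀ y, 0 < b y := fun y => hm.trans_le (hmb y)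
  have hI := integral_inv_pos_of_le hb hm hmb
  have h1 : (volume.withDensity fun y => ENNReal.ofReal (κ / b y)) univ =
      ENNReal.ofReal (κ * ∫ y, (b y)⁻¹) := by
    rw [withDensity_apply _ MeasurableSet.univ, Measure.restrict_univ, ← integral_const_mul]
    by_cases hκ : 0 ≤ κ
    · rw [ofReal_integral_eq_lintegral_ofReal ((integrable_inv_of_le hb hm hmb).const_mul κ)
        (ae_of_all _ fun y => mul_nonneg hκ (inv_pos.mpr (hpos y)).le)]
      rfl
    -- For `κ < 0` the density is truncated to zero, consistently with the truncated right side.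
    · push Not at hκ
      rw [integral_const_mul, ENNReal.ofReal_of_nonpos (by nlinarith)]
      simp [ENNReal.ofReal_of_nonpos (div_nonpos_of_nonpos_of_nonneg hκ.le (hpos _).le)]
  rw [isProbabilityMeasure_iff, h1, ENNReal.ofReal_eq_one, harmonicMean]
  exact ⟨eq_inv_of_mul_eq_one_left, fun h => by rw [h, inv_mul_cancel₀ hI.ne']⟩

lemma integral_invMeasure {b : Torus d → ℝ} (hb : Measurable b) {m : ℝ}
    (hm : 0 < m) (hmb : ∀ y, m ≤ b y) (f : Torus d → ℝ) :
    ∫ y, f y ∂(invMeasure b) = ∫ y, harmonicMean b / b y * f y := by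
  have hpos : ∀ y, 0 < b y := fun y => hm.trans_le (hmb y)
  have hI := integral_inv_pos_of_le hb hm hmb
  rw [invMeasure, integral_withDensity_eq_integral_toReal_smul
    (hb.const_div _).ennreal_ofReal (ae_of_all _ fun _ => ENNReal.ofReal_lt_top)]
  refine integral_congr_ae (ae_of_all _ fun y => ?_)
  have hH : 0 ≤ harmonicMean b := inv_nonneg.mpr hI.le
  simp only [smul_eq_mul]
  rw [ENNReal.toReal_ofReal (div_nonneg hH (hpos y).le)]

/-- A measure annihilating all `A : D² φ` is a multiple of the volume. -/
lemma eq_smul_volume_of_integral_frob_torusHess {A : Matrix (Fin d) (Fin d) ℝ} (hA : A.PosDef)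
    (μ : Measure (Torus d)) [IsFiniteMeasure μ]
    (h : ∀ φ : Torus d → ℝ, IsC2 φ → ∫ y, frob A (torusHess φ y) ∂μ = 0) :
    μ = μ univ • (volume : Measure (Torus d)) := by
  have : IsFiniteMeasure (μ univ • (volume : Measure (Torus d))) :=
    Measure.smul_finite _ (measure_ne_top _ _)
  refine ext_of_forall_integral_eq_of_IsFiniteMeasure fun f => ?_
  have hf := f.continuous
  have hfv := integrable_of_continuous hf (volume : Measure (Torus d))
  have hfμ := integrable_of_continuous hf μ
  set a := ∫ y, f y with ha
  -- `f - a` is uniformly close to some `A : D²w`, whose integral against `μ` is zero; hence `μ`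
  -- integrates `f` to `a` times its mass.
  obtain ⟨u, -, hu⟩ := exists_approx_solution hA (f := fun y => f y - a)
    (hf.sub continuous_const) (by rw [integral_sub hfv (integrable_const _)]; simp [ha])
  have h0 : ∀ δ > 0, |∫ y, (f y - a) ∂μ| ≤ δ * μ.real univ := by
    intro δ hδ
    obtain ⟨w, hw, -, hwf⟩ := hu δ hδ
    have h1 : ∫ y, (f y - a) ∂μ = -∫ y, (frob A (torusHess w y) - (f y - a)) ∂μ := by
      have hi : Integrable (fun y => f y - a) μ := hfμ.sub (integrable_const _)
      rw [integral_sub (integrable_of_continuous (hw.continuous_frob_torusHess A) μ) hi, h w hw]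
      ring
    rw [h1, abs_neg]
    exact norm_integral_le_of_norm_le_const
      (f := fun y => frob A (torusHess w y) - (f y - a)) (ae_of_all _ hwf)
  have h1 : ∫ y, (f y - a) ∂μ = 0 := by
    have hlim : Tendsto (fun δ : ℝ => δ * μ.real univ) (𝓝[>] 0) (𝓝 0) := by
      have : Tendsto (fun δ : ℝ => δ * μ.real univ) (𝓝 0) (𝓝 (0 * μ.real univ)) :=
        tendsto_id.mul_const _
      rw [zero_mul] at this
      exact this.mono_left nhdsWithin_le_nhds
    exact abs_nonpos_iff.mp (ge_of_tendsto hlim (by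
      filter_upwards [self_mem_nhdsWithin] with δ hδ using h0 δ hδ))
  rw [integral_sub hfμ (integrable_const _), integral_const, sub_eq_zero] at h1
  rw [h1, integral_smul_measure]
  rfl

/-- The unique invariant measure of `b A : D²` has density proportional to `b⁻¹`. -/
lemma isInvariantMeasure_iff {A : Matrix (Fin d) (Fin d) ℝ} (hA : A.PosDef) {b : Torus d → ℝ}
    (hb : Measurable b) {m M : ℝ} (hm : 0 < m) (hmb : ∀ y, m ≤ b y) (hbM : ∀ y, b y ≤ M)
    (ρ : Measure (Torus d)) :
    IsInvariantMeasure (fun y => b y • A) ρ ↔ ρ = invMeasure b := by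
  have hpos : ∀ y, 0 < b y := fun y => hm.trans_le (hmb y)
  constructor
  · rintro ⟨hρ, h⟩
    have hbm : Measurable fun y => ENNReal.ofReal (b y) := hb.ennreal_ofReal
    have hbint : Integrable b ρ := .of_bound hb.aestronglyMeasurable M (ae_of_all _ fun y => by
      rw [Real.norm_of_nonneg (hpos y).le]; exact hbM y)
    have : IsFiniteMeasure (ρ.withDensity fun y => ENNReal.ofReal (b y)) :=
      isFiniteMeasure_withDensity_ofReal hbint.2
    -- The scalar `b` is absorbed into the measure: `b ρ` annihilates every `A : D²φ`, so it is `κ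
    -- dy`. Dividing by `b` recovers `ρ`, and total mass one fixes `κ`.
    have h1 := eq_smul_volume_of_integral_frob_torusHess hA
      (ρ.withDensity fun y => ENNReal.ofReal (b y)) fun φ hφ => by
        rw [integral_withDensity_eq_integral_toReal_smul hbm
          (ae_of_all _ fun _ => ENNReal.ofReal_lt_top), ← h φ hφ]
        refine integral_congr_ae (ae_of_all _ fun y => ?_)
        simp only [smul_frob, smul_eq_mul]
        rw [ENNReal.toReal_ofReal (hpos y).le]
    set κ := (ρ.withDensity fun y => ENNReal.ofReal (b y)) univ with hκ
    have hκtop : κ ≠ ⊤ := measure_ne_top _ _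
    have h2 : ρ = volume.withDensity fun y => ENNReal.ofReal (κ.toReal / b y) := by
      rw [← withDensity_inv_same (μ := ρ) hbm
        (ae_of_all _ fun y => (ENNReal.ofReal_pos.mpr (hpos y)).ne')
        (ae_of_all _ fun y => ENNReal.ofReal_ne_top), h1, withDensity_smul_measure,
        ← withDensity_smul κ (f := fun y => (ENNReal.ofReal (b y))⁻¹) hbm.inv]
      congr 1
      ext y
      rw [ENNReal.ofReal_div_of_pos (hpos y), ENNReal.ofReal_toReal hκtop]
      rfl
    have h3 : κ.toReal = harmonicMean b := by
      rw [← isProbabilityMeasure_withDensity_div hb hm hmb, ← h2]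
      exact hρ
    rw [h2, h3, invMeasure]
  · rintro rfl
    refine ⟨(isProbabilityMeasure_withDensity_div hb hm hmb _).mpr rfl, fun φ hφ => ?_⟩
    rw [integral_invMeasure hb hm hmb]
    have : ∀ y, harmonicMean b / b y * frob (b y • A) (torusHess φ y) =
        harmonicMean b * frob A (torusHess φ y) := fun y => by
      have := (hpos y).ne'
      rw [smul_frob]; field_simp
    simp only [this, integral_const_mul, hφ.integral_frob_torusHess, mul_zero]

/-! ### Controls and their homogenized linear operators. -/

lemma exists_control_bounds {a₀ a₁ α : Torus d → ℝ} (ha₀ : Continuous a₀) (ha₁ : Continuous a₁)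
    (ha₀_pos : ∀ y, 0 < a₀ y) (ha₁_pos : ∀ y, 0 < a₁ y) (hα : IsControl α) :
    ∃ m M, 0 < m ∧ (∀ y, m ≤ a₀ y + α y * a₁ y) ∧ ∀ y, a₀ y + α y * a₁ y ≤ M := by
  obtain ⟨y₁, -, hy₁⟩ := isCompact_univ.exists_isMinOn ⟨0, mem_univ 0⟩ ha₀.continuousOn
  obtain ⟨y₂, -, hy₂⟩ := isCompact_univ.exists_isMaxOn ⟨0, mem_univ 0⟩ (ha₀.add ha₁).continuousOn
  refine ⟨a₀ y₁, a₀ y₂ + a₁ y₂, ha₀_pos y₁, fun y => ?_, fun y => ?_⟩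
  · have h1 : a₀ y₁ ≤ a₀ y := hy₁ (mem_univ y)
    have := mul_nonneg (hα.2 y).1 (ha₁_pos y).le
    linarith
  · have h1 : a₀ y + a₁ y ≤ a₀ y₂ + a₁ y₂ := hy₂ (mem_univ y)
    have := mul_le_mul_of_nonneg_right (hα.2 y).2 (ha₁_pos y).le
    linarith

/-- The dependence on `t` is affine with slope `-a₁ A : Q`, so an endpoint chosen by the sign of `A
: Q` is optimal. -/
lemma isGreatest_linOp {a₀ a₁ : Torus d → ℝ} (A : Matrix (Fin d) (Fin d) ℝ) (h : ℝ)
    (ha₁_pos : ∀ y, 0 < a₁ y) (Q : Matrix (Fin d) (Fin d) ℝ) (y : Torus d) :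
    IsGreatest ((fun t => linOp a₀ a₁ A h t Q y) '' Icc (0 : ℝ) 1) (maxOp a₀ a₁ A h Q y) := by
  have h1 := ha₁_pos y
  constructor
  · obtain hq | hq := le_total 0 (frob A Q)
    · refine ⟨0, by simp, ?_⟩
      simp only [linOp, maxOp]
      rw [max_eq_left (by nlinarith)]
      ring
    · refine ⟨1, by simp, ?_⟩
      simp only [linOp, maxOp]
      rw [max_eq_right (by nlinarith)]
      ring
  · rintro _ ⟨t, ht, rfl⟩
    simp only [linOp, maxOp]
    gcongr
    obtain hq | hq := le_total 0 (frob A Q)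
    · exact le_max_of_le_left (by nlinarith [mul_nonneg (mul_nonneg ht.1 h1.le) hq])
    · refine le_max_of_le_right ?_
      nlinarith [mul_nonneg (mul_nonneg (sub_nonneg.mpr ht.2) h1.le) (neg_nonneg.mpr hq)]

lemma IsControl.measurable_add_mul {a₀ a₁ α : Torus d → ℝ} (hα : IsControl α)
    (ha₀ : Continuous a₀) (ha₁ : Continuous a₁) : Measurable fun y => a₀ y + α y * a₁ y :=
  ha₀.measurable.add (hα.1.mul ha₁.measurable)

lemma isInvariantMeasure_control_iff {a₀ a₁ : Torus d → ℝ} {A : Matrix (Fin d) (Fin d) ℝ}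
    (ha₀ : Continuous a₀) (ha₁ : Continuous a₁)
    (ha₀_pos : ∀ y, 0 < a₀ y) (ha₁_pos : ∀ y, 0 < a₁ y) (hA : A.PosDef)
    {α : Torus d → ℝ} (hα : IsControl α) (ρ : Measure (Torus d)) :
    IsInvariantMeasure (fun y => (a₀ y + α y * a₁ y) • A) ρ ↔
      ρ = invMeasure fun y => a₀ y + α y * a₁ y := by
  obtain ⟨m, M, hm, hmb, hbM⟩ := exists_control_bounds ha₀ ha₁ ha₀_pos ha₁_pos hα
  exact isInvariantMeasure_iff hA (hα.measurable_add_mul ha₀ ha₁) hm hmb hbM ρ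

lemma isLinearValue_iff {a₀ a₁ : Torus d → ℝ} {A : Matrix (Fin d) (Fin d) ℝ} (h : ℝ)
    (ha₀ : Continuous a₀) (ha₁ : Continuous a₁)
    (ha₀_pos : ∀ y, 0 < a₀ y) (ha₁_pos : ∀ y, 0 < a₁ y) (hA : A.PosDef)
    {α : Torus d → ℝ} (hα : IsControl α) (Q : Matrix (Fin d) (Fin d) ℝ) (c : ℝ) :
    IsLinearValue a₀ a₁ A h α Q c ↔
      c = -(harmonicMean (fun y => a₀ y + α y * a₁ y) * frob A Q) + h := by
  obtain ⟨m, M, hm, hmb, hbM⟩ := exists_control_bounds ha₀ ha₁ ha₀_pos ha₁_pos hα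
  have hb := hα.measurable_add_mul ha₀ ha₁
  set b : Torus d → ℝ := fun y => a₀ y + α y * a₁ y with hbdef
  have hI := integral_inv_pos_of_le hb hm hmb
  have hval : ∫ y, linOp a₀ a₁ A h (α y) Q y ∂(invMeasure b) =
      -(harmonicMean b * frob A Q) + h := by
    rw [integral_invMeasure hb hm hmb]
    -- The density cancels `b` in the second-order term, leaving a constant; the remaining `b⁻¹`
    -- integrates to the inverse of the harmonic mean and returns `h`.
    have h1 : ∀ y, harmonicMean b / b y * linOp a₀ a₁ A h (α y) Q y =
        -(harmonicMean b * frob A Q) + harmonicMean b * h * (b y)⁻¹ := fun y => by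
      have h2 : b y ≠ 0 := (hm.trans_le (hmb y)).ne'
      have h3 : linOp a₀ a₁ A h (α y) Q y = -(b y * frob A Q) + h := rfl
      rw [h3]
      field_simp
    simp only [h1]
    rw [integral_add (integrable_const _) ((integrable_inv_of_le hb hm hmb).const_mul _),
      integral_const_mul, integral_const, probReal_univ, one_smul, add_right_inj, harmonicMean,
      mul_right_comm, inv_mul_cancel₀ hI.ne', one_mul]
  have hinv := isInvariantMeasure_control_iff ha₀ ha₁ ha₀_pos ha₁_pos hA hα
  constructor
  · rintro ⟨ρ, hρ, rfl⟩
    rw [(hinv ρ).mp hρ, hval]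
  · rintro rfl
    exact ⟨invMeasure b, (hinv _).mpr rfl, hval.symm⟩

lemma harmonicMean_control_mono {a₀ a₁ α β : Torus d → ℝ}
    (ha₀ : Continuous a₀) (ha₁ : Continuous a₁)
    (ha₀_pos : ∀ y, 0 < a₀ y) (ha₁_pos : ∀ y, 0 < a₁ y) (hα : IsControl α) (hβ : IsControl β)
    (hαβ : ∀ y, α y ≤ β y) :
    harmonicMean (fun y => a₀ y + α y * a₁ y) ≤ harmonicMean (fun y => a₀ y + β y * a₁ y) := by
  obtain ⟨m, M, hm, hmb, hbM⟩ := exists_control_bounds ha₀ ha₁ ha₀_pos ha₁_pos hα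
  obtain ⟨m', M', hm', hmb', hbM'⟩ := exists_control_bounds ha₀ ha₁ ha₀_pos ha₁_pos hβ
  have hbα := hα.measurable_add_mul ha₀ ha₁
  have hbβ := hβ.measurable_add_mul ha₀ ha₁
  refine harmonicMean_le (integrable_inv_of_le hbα hm hmb) (integrable_inv_of_le hbβ hm' hmb')
    (fun y => hm.trans_le (hmb y)) (fun y => ?_) (integral_inv_pos_of_le hbβ hm' hmb')
  have := mul_le_mul_of_nonneg_right (hαβ y) (ha₁_pos y).le
  linarith

end

end PeriodicCell

end

theorem mainTheorem2 {d : ℕ} (a₀ a₁ : Torus d → ℝ) (A : Matrix (Fin d) (Fin d) ℝ) (h : ℝ)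
    (ha₀ : Continuous a₀) (ha₁ : Continuous a₁)
    (ha₀_pos : ∀ y, 0 < a₀ y) (ha₁_pos : ∀ y, 0 < a₁ y) (hA : A.PosDef) :
    -- the cell problem has a solution for exactly one value, given by the formula
    (∀ Q : Matrix (Fin d) (Fin d) ℝ, Q.IsSymm → ∀ c : ℝ,
      IsCellValue (maxOp a₀ a₁ A h) Q c ↔
        c = max (-(harmonicMean a₀ * frob A Q))
              (-(harmonicMean (fun y => a₀ y + a₁ y) * frob A Q)) + h) ∧
    -- the operator is the maximum of the linear operators over the control values
    (∀ (Q : Matrix (Fin d) (Fin d) ℝ) (y : Torus d), Q.IsSymm →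
      IsGreatest ((fun t => linOp a₀ a₁ A h t Q y) '' Set.Icc (0 : ℝ) 1)
        (maxOp a₀ a₁ A h Q y)) ∧
    -- the unique invariant probability measure of a control, with `b = a₀ + α a₁`
    (∀ α : Torus d → ℝ, IsControl α → ∀ ρ : MeasureTheory.Measure (Torus d),
      IsInvariantMeasure (fun y => (a₀ y + α y * a₁ y) • A) ρ ↔
        ρ = MeasureTheory.volume.withDensity (fun y => ENNReal.ofReal
          (harmonicMean (fun z => a₀ z + α z * a₁ z) / (a₀ y + α y * a₁ y)))) ∧
    -- the homogenized linear operator of a control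
    (∀ α : Torus d → ℝ, IsControl α → ∀ Q : Matrix (Fin d) (Fin d) ℝ, Q.IsSymm → ∀ c : ℝ,
      IsLinearValue a₀ a₁ A h α Q c ↔
        c = -(harmonicMean (fun y => a₀ y + α y * a₁ y) * frob A Q) + h) ∧
    -- the homogenized operator is the maximum over all controls, attained at a constant
    -- control that is chosen by the sign of `A : Q`
    (∀ Q : Matrix (Fin d) (Fin d) ℝ, Q.IsSymm → ∀ c : ℝ,
      IsCellValue (maxOp a₀ a₁ A h) Q c →
        IsGreatest {r : ℝ | ∃ α : Torus d → ℝ, IsControl α ∧ IsLinearValue a₀ a₁ A h α Q r} c ∧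
        (0 ≤ frob A Q → IsLinearValue a₀ a₁ A h (fun _ => 0) Q c) ∧
        (frob A Q ≤ 0 → IsLinearValue a₀ a₁ A h (fun _ => 1) Q c)) := by
  refine ⟨fun Q _ c => isCellValue_iff h ha₀ ha₁ ha₀_pos ha₁_pos hA Q c,
    fun Q y _ => isGreatest_linOp A h ha₁_pos Q y,
    fun α hα ρ => isInvariantMeasure_control_iff ha₀ ha₁ ha₀_pos ha₁_pos hA hα ρ,
    fun α hα Q _ c => isLinearValue_iff h ha₀ ha₁ ha₀_pos ha₁_pos hA hα Q c, fun Q _ c hc => ?_⟩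
  have hα₀ : IsControl fun _ : Torus d => (0 : ℝ) := ⟨measurable_const, fun _ => by simp⟩
  have hα₁ : IsControl fun _ : Torus d => (1 : ℝ) := ⟨measurable_const, fun _ => by simp⟩
  have hval := fun α (hα : IsControl α) => isLinearValue_iff h ha₀ ha₁ ha₀_pos ha₁_pos hA hα Q
  have hmono := fun α β (hα : IsControl α) (hβ : IsControl β) =>
    harmonicMean_control_mono ha₀ ha₁ ha₀_pos ha₁_pos hα hβ
  rw [isCellValue_iff h ha₀ ha₁ ha₀_pos ha₁_pos hA] at hc
  have h0 : (fun y => a₀ y + 0 * a₁ y) = a₀ := by simp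
  have h1 : (fun y => a₀ y + 1 * a₁ y) = fun y => a₀ y + a₁ y := by simp
  have h01 := hmono _ _ hα₀ hα₁ fun _ => zero_le_one
  rw [h0, h1] at h01
  have hpos : 0 ≤ frob A Q → IsLinearValue a₀ a₁ A h (fun _ => 0) Q c := fun hq => by
    rw [hval _ hα₀, h0, hc, max_eq_left (by nlinarith)]
  have hneg : frob A Q ≤ 0 → IsLinearValue a₀ a₁ A h (fun _ => 1) Q c := fun hq => by
    rw [hval _ hα₁, h1, hc, max_eq_right (by nlinarith)]
  refine ⟨⟨?_, ?_⟩, hpos, hneg⟩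
  · obtain hq | hq := le_total 0 (frob A Q)
    · exact ⟨_, hα₀, hpos hq⟩
    · exact ⟨_, hα₁, hneg hq⟩
  · rintro r ⟨α, hα, hr⟩
    rw [hval α hα] at hr
    -- Since `0 ≤ α ≤ 1`, `HM(b)` lies between `HM(a₀)` and `HM(a₀ + a₁)`, so one of the two
    -- constant controls does at least as well as `α`.
    have h2 := hmono _ _ hα₀ hα fun y => (hα.2 y).1
    have h3 := hmono _ _ hα hα₁ fun y => (hα.2 y).2
    rw [h0] at h2
    rw [h1] at h3
    rw [hr, hc]
    gcongr
    obtain hq | hq := le_total 0 (frob A Q)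
    · exact le_max_of_le_left (by nlinarith)
    · exact le_max_of_le_right (by nlinarith)
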